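/- Let $K$ be a field, let $C$ and $D$ be $K$-coalgebras with $D$ finite dimensional, and let $\lambda : C \to D$ be a morphism of coalgebras. Let $U : \mathcal{M}^{C} \to \mathcal{M}^{D}$ be the corestriction functor between the categories of right comodules, which sends $(M,\, m \mapsto m_0 \otimes m_1)$ to $(M,\, m \mapsto m_0 \otimes \lambda(m_1))$ and is the identity on morphisms. Let $C^* = \mathrm{Hom}_K(C,K)$ and $D^* = \mathrm{Hom}_K(D,K)$ be the dual algebras with the convolution product, and let $\lambda^* : D^* \to C^*$, $g \mapsto g \circ \lambda$. The following are equivalent: (i) $\lambda : C \to D$ is a Frobenius extension of coalgebras, i.e. $U$ is a Frobenius functor: $U$ has a left adjoint and a right adjoint, and these are naturally isomorphic. (ii) $\lambda^* : D^* \to C^*$ is a Frobenius extension of algebras, i.e. $C^*$ is a finitely generated projective left $D^*$-module and $C^* \simeq \mathrm{Hom}_{D^*}(C^*, D^*)$ (left $D^*$-linear maps) as $(C^*, D^*)$-bimodules. In this case $C$ is finite dimensional; $C$ is injective and finitely cogenerated (that is, it embeds into $D^n$ for some $n \in \mathbb{N}$) both as a right $D$-comodule via $c \mapsto c_1 \otimes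 \lambda(c_2)$ and as a left $D$-comodule via $c \mapsto \lambda(c_1) \otimes c_2$; and $C^*$ is finitely generated both as a left and as a right $D^*$-module. -/

import Mathlib

open CategoryTheory
open scoped TensorProduct

universe u v w

noncomputable section

/-! ### Right comodules -/

/-- A right comodule over a `K`-coalgebra `C`: a `K`-vector space `M` with a coassociative and
counital coaction `M → M ⊗ C`. -/
structure RightComod (K : Type u) [Field K] (C : Type v) [AddCommGroup C] [Module K C]
    [Coalgebra K C] where
  /-- the underlying vector space -/
  carrier : Type w
  [isAddCommGroup : AddCommGroup carrier]
  [isModule : Module K carrier]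
  /-- the coaction `m ↦ m₀ ⊗ m₁` -/
  coact : carrier →ₗ[K] carrier ⊗[K] C
  coact_coassoc : (TensorProduct.assoc K carrier C C).toLinearMap ∘ₗ coact.rTensor C ∘ₗ coact =
    (Coalgebra.comul (R := K) (A := C)).lTensor carrier ∘ₗ coact
  coact_counit : (TensorProduct.rid K carrier).toLinearMap ∘ₗ
    (Coalgebra.counit (R := K) (A := C)).lTensor carrier ∘ₗ coact = LinearMap.id

attribute [instance] RightComod.isAddCommGroup RightComod.isModule

namespace RightComod

section

variable {K : Type u} [Field K] {C : Type v} [AddCommGroup C] [Module K C] [Coalgebra K C]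

/-- Morphisms of right comodules: linear maps commuting with the coactions. -/
@[ext]
structure Hom (M N : RightComod.{u, v, w} K C) where
  /-- the underlying linear map -/
  toLin : M.carrier →ₗ[K] N.carrier
  comm : toLin.rTensor C ∘ₗ M.coact = N.coact ∘ₗ toLin

/-- The category of right `C`-comodules. -/
instance : Category (RightComod.{u, v, w} K C) where
  Hom M N := Hom M N
  id M := ⟨LinearMap.id, by simp⟩
  comp f g := ⟨g.toLin ∘ₗ f.toLin, by
    rw [LinearMap.rTensor_comp, LinearMap.comp_assoc, f.comm, ← LinearMap.comp_assoc, g.comm,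
      LinearMap.comp_assoc]⟩

end

section

variable (K : Type u) [Field K] (C : Type v) [AddCommGroup C] [Module K C] [Coalgebra K C]

/-- `C` as a right comodule over itself. -/
abbrev regular : RightComod.{u, v, v} K C where
  carrier := C
  coact := Coalgebra.comul
  coact_coassoc := Coalgebra.coassoc
  coact_counit := by
    rw [Coalgebra.lTensor_counit_comp_comul]
    ext; simp

/-- The direct sum `Cⁿ` of `n` copies of the right comodule `C`, with coaction
`(cᵢ)ᵢ ↦ ∑ᵢ eᵢ(cᵢ₁) ⊗ cᵢ₂`, where `eᵢ` is the `i`-th inclusion `C → Cⁿ`. -/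
abbrev power (n : ℕ) : RightComod.{u, v, v} K C where
  carrier := Fin n → C
  coact := LinearMap.lsum K (fun _ : Fin n => C) K fun i =>
    (LinearMap.single K (fun _ : Fin n => C) i).rTensor C ∘ₗ Coalgebra.comul
  coact_coassoc := by
    refine LinearMap.pi_ext' fun i => ?_
    have key : (TensorProduct.assoc K (Fin n → C) C C).toLinearMap ∘ₗ
        ((LinearMap.single K (fun _ : Fin n => C) i).rTensor C ∘ₗ Coalgebra.comul).rTensor C =
        (LinearMap.single K (fun _ : Fin n => C) i).rTensor (C ⊗[K] C) ∘ₗ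
        (TensorProduct.assoc K C C C).toLinearMap ∘ₗ Coalgebra.comul.rTensor C := by
      rw [LinearMap.rTensor_comp, ← LinearMap.comp_assoc, ← LinearMap.comp_assoc]
      congr 1
      ext; simp
    have hl : (LinearMap.lsum K (fun _ : Fin n => C) K fun i =>
        (LinearMap.single K (fun _ : Fin n => C) i).rTensor C ∘ₗ Coalgebra.comul) ∘ₗ
        LinearMap.single K (fun _ : Fin n => C) i =
        (LinearMap.single K (fun _ : Fin n => C) i).rTensor C ∘ₗ Coalgebra.comul := by
      refine LinearMap.ext fun x => ?_
      exact LinearMap.lsum_piSingle K (fun _ : Fin n => C) K _ i x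
    rw [LinearMap.comp_assoc, LinearMap.comp_assoc, LinearMap.comp_assoc, hl,
      ← LinearMap.comp_assoc _ _ (LinearMap.rTensor C _), ← LinearMap.rTensor_comp, hl,
      ← LinearMap.comp_assoc, key, LinearMap.comp_assoc, LinearMap.comp_assoc, Coalgebra.coassoc,
      ← LinearMap.comp_assoc, ← LinearMap.comp_assoc, LinearMap.rTensor_comp_lTensor,
      LinearMap.lTensor_comp_rTensor]
  coact_counit := by
    refine LinearMap.pi_ext' fun i => ?_
    have hl : (LinearMap.lsum K (fun _ : Fin n => C) K fun i =>
        (LinearMap.single K (fun _ : Fin n => C) i).rTensor C ∘ₗ Coalgebra.comul) ∘ₗ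
        LinearMap.single K (fun _ : Fin n => C) i =
        (LinearMap.single K (fun _ : Fin n => C) i).rTensor C ∘ₗ Coalgebra.comul := by
      refine LinearMap.ext fun x => ?_
      exact LinearMap.lsum_piSingle K (fun _ : Fin n => C) K _ i x
    rw [LinearMap.comp_assoc, LinearMap.comp_assoc, hl, ← LinearMap.comp_assoc _ _ (.lTensor _ _),
      LinearMap.lTensor_comp_rTensor, ← LinearMap.rTensor_comp_lTensor, LinearMap.comp_assoc,
      Coalgebra.lTensor_counit_comp_comul]
    ext; simp

end

section

variable {K : Type u} [Field K] {C D : Type v} [AddCommGroup C] [Module K C] [Coalgebra K C]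
  [AddCommGroup D] [Module K D] [Coalgebra K D]

/-- The right `D`-comodule `M`, `m ↦ m₀ ⊗ f(m₁)`, obtained from a right `C`-comodule `M`
along a coalgebra map `f : C → D`. -/
abbrev corestrictObj (f : C →ₗc[K] D) (M : RightComod.{u, v, w} K C) : RightComod.{u, v, w} K D where
  carrier := M.carrier
  coact := f.toLinearMap.lTensor M.carrier ∘ₗ M.coact
  coact_coassoc := by
    have key : (TensorProduct.assoc K M.carrier D D).toLinearMap ∘ₗ
        (f.toLinearMap.lTensor M.carrier ∘ₗ M.coact).rTensor D ∘ₗ f.toLinearMap.lTensor M.carrier =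
        (TensorProduct.map f.toLinearMap f.toLinearMap).lTensor M.carrier ∘ₗ
        (TensorProduct.assoc K M.carrier C C).toLinearMap ∘ₗ M.coact.rTensor C := by
      rw [LinearMap.rTensor_comp, LinearMap.comp_assoc, LinearMap.rTensor_comp_lTensor,
        ← LinearMap.lTensor_comp_rTensor, ← LinearMap.comp_assoc, ← LinearMap.comp_assoc,
        ← LinearMap.comp_assoc]
      congr 1
      ext; simp
    rw [← LinearMap.comp_assoc _ _ (LinearMap.rTensor D _), ← LinearMap.comp_assoc, key,
      LinearMap.comp_assoc, LinearMap.comp_assoc, M.coact_coassoc, ← LinearMap.comp_assoc,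
      ← LinearMap.comp_assoc, ← LinearMap.lTensor_comp, ← LinearMap.lTensor_comp,
      f.map_comp_comul]
  coact_counit := by
    rw [← LinearMap.comp_assoc _ _ (LinearMap.lTensor _ _), ← LinearMap.lTensor_comp,
      f.counit_comp, M.coact_counit]

/-- The corestriction functor from right `C`-comodules to right `D`-comodules. -/
abbrev corestrict (f : C →ₗc[K] D) : RightComod.{u, v, w} K C ⥤ RightComod.{u, v, w} K D where
  obj M := corestrictObj f M
  map {M N} g := ⟨g.toLin, by
    change g.toLin.rTensor D ∘ₗ f.toLinearMap.lTensor M.carrier ∘ₗ M.coact =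
      (f.toLinearMap.lTensor N.carrier ∘ₗ N.coact) ∘ₗ g.toLin
    rw [LinearMap.comp_assoc, ← g.comm, ← LinearMap.comp_assoc, ← LinearMap.comp_assoc,
      LinearMap.rTensor_comp_lTensor, LinearMap.lTensor_comp_rTensor]⟩

end

end RightComod

/-! ### Left comodules -/

/-- A left comodule over a `K`-coalgebra `C`: a `K`-vector space `M` with a coassociative and
counital coaction `M → C ⊗ M`. -/
structure LeftComod (K : Type u) [Field K] (C : Type v) [AddCommGroup C] [Module K C]
    [Coalgebra K C] where
  /-- the underlying vector space -/
  carrier : Type w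
  [isAddCommGroup : AddCommGroup carrier]
  [isModule : Module K carrier]
  /-- the coaction `m ↦ m₋₁ ⊗ m₀` -/
  coact : carrier →ₗ[K] C ⊗[K] carrier
  coact_coassoc : (TensorProduct.assoc K C C carrier).toLinearMap ∘ₗ
      (Coalgebra.comul (R := K) (A := C)).rTensor carrier ∘ₗ coact =
    coact.lTensor C ∘ₗ coact
  coact_counit : (TensorProduct.lid K carrier).toLinearMap ∘ₗ
    (Coalgebra.counit (R := K) (A := C)).rTensor carrier ∘ₗ coact = LinearMap.id

attribute [instance] LeftComod.isAddCommGroup LeftComod.isModule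

namespace LeftComod

section

variable {K : Type u} [Field K] {C : Type v} [AddCommGroup C] [Module K C] [Coalgebra K C]

/-- Morphisms of left comodules: linear maps commuting with the coactions. -/
@[ext]
structure Hom (M N : LeftComod.{u, v, w} K C) where
  /-- the underlying linear map -/
  toLin : M.carrier →ₗ[K] N.carrier
  comm : toLin.lTensor C ∘ₗ M.coact = N.coact ∘ₗ toLin

/-- The category of left `C`-comodules. -/
instance : Category (LeftComod.{u, v, w} K C) where
  Hom M N := Hom M N
  id M := ⟨LinearMap.id, by simp⟩
  comp f g := ⟨g.toLin ∘ₗ f.toLin, by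
    rw [LinearMap.lTensor_comp, LinearMap.comp_assoc, f.comm, ← LinearMap.comp_assoc, g.comm,
      LinearMap.comp_assoc]⟩

end

section

variable (K : Type u) [Field K] (C : Type v) [AddCommGroup C] [Module K C] [Coalgebra K C]

/-- `C` as a left comodule over itself. -/
abbrev regular : LeftComod.{u, v, v} K C where
  carrier := C
  coact := Coalgebra.comul
  coact_coassoc := Coalgebra.coassoc
  coact_counit := by
    rw [Coalgebra.rTensor_counit_comp_comul]
    ext; simp

/-- The direct sum `Cⁿ` of `n` copies of the left comodule `C`, with coaction
`(cᵢ)ᵢ ↦ ∑ᵢ cᵢ₁ ⊗ eᵢ(cᵢ₂)`, where `eᵢ` is the `i`-th inclusion `C → Cⁿ`. -/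
abbrev power (n : ℕ) : LeftComod.{u, v, v} K C where
  carrier := Fin n → C
  coact := LinearMap.lsum K (fun _ : Fin n => C) K fun i =>
    (LinearMap.single K (fun _ : Fin n => C) i).lTensor C ∘ₗ Coalgebra.comul
  coact_coassoc := by
    refine LinearMap.pi_ext' fun i => ?_
    have key : (LinearMap.single K (fun _ : Fin n => C) i).lTensor C ∘ₗ Coalgebra.comul =
        (LinearMap.lsum K (fun _ : Fin n => C) K fun i =>
          (LinearMap.single K (fun _ : Fin n => C) i).lTensor C ∘ₗ Coalgebra.comul) ∘ₗ
        LinearMap.single K (fun _ : Fin n => C) i := by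
      symm
      refine LinearMap.ext fun x => ?_
      exact LinearMap.lsum_piSingle K (fun _ : Fin n => C) K _ i x
    have hs : (TensorProduct.assoc K C C (Fin n → C)).toLinearMap ∘ₗ
        (LinearMap.single K (fun _ : Fin n => C) i).lTensor (C ⊗[K] C) =
        ((LinearMap.single K (fun _ : Fin n => C) i).lTensor C).lTensor C ∘ₗ
        (TensorProduct.assoc K C C C).toLinearMap := by
      ext; simp
    rw [LinearMap.comp_assoc, LinearMap.comp_assoc, LinearMap.comp_assoc, ← key,
      ← LinearMap.comp_assoc _ _ (LinearMap.lTensor C _), ← LinearMap.lTensor_comp, ← key,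
      ← LinearMap.comp_assoc _ _ (LinearMap.rTensor _ _), LinearMap.rTensor_comp_lTensor,
      ← LinearMap.lTensor_comp_rTensor, ← LinearMap.comp_assoc, ← LinearMap.comp_assoc, hs,
      LinearMap.comp_assoc, LinearMap.comp_assoc, Coalgebra.coassoc, LinearMap.lTensor_comp,
      LinearMap.comp_assoc]
  coact_counit := by
    refine LinearMap.pi_ext' fun i => ?_
    have hl : (LinearMap.lsum K (fun _ : Fin n => C) K fun i =>
        (LinearMap.single K (fun _ : Fin n => C) i).lTensor C ∘ₗ Coalgebra.comul) ∘ₗ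
        LinearMap.single K (fun _ : Fin n => C) i =
        (LinearMap.single K (fun _ : Fin n => C) i).lTensor C ∘ₗ Coalgebra.comul := by
      refine LinearMap.ext fun x => ?_
      exact LinearMap.lsum_piSingle K (fun _ : Fin n => C) K _ i x
    rw [LinearMap.comp_assoc, LinearMap.comp_assoc, hl, ← LinearMap.comp_assoc _ _ (.rTensor _ _),
      LinearMap.rTensor_comp_lTensor, ← LinearMap.lTensor_comp_rTensor, LinearMap.comp_assoc,
      Coalgebra.rTensor_counit_comp_comul]
    ext; simp

end

section

variable {K : Type u} [Field K] {C D : Type v} [AddCommGroup C] [Module K C] [Coalgebra K C]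
  [AddCommGroup D] [Module K D] [Coalgebra K D]

/-- The left `D`-comodule `M`, `m ↦ f(m₋₁) ⊗ m₀`, obtained from a left `C`-comodule `M`
along a coalgebra map `f : C → D`. -/
abbrev corestrictObj (f : C →ₗc[K] D) (M : LeftComod.{u, v, w} K C) : LeftComod.{u, v, w} K D where
  carrier := M.carrier
  coact := f.toLinearMap.rTensor M.carrier ∘ₗ M.coact
  coact_coassoc := by
    have hs : (TensorProduct.assoc K D D M.carrier).toLinearMap ∘ₗ
        (TensorProduct.map f.toLinearMap f.toLinearMap).rTensor M.carrier =
        f.toLinearMap.rTensor (D ⊗[K] M.carrier) ∘ₗ (f.toLinearMap.rTensor M.carrier).lTensor C ∘ₗ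
        (TensorProduct.assoc K C C M.carrier).toLinearMap := by
      ext; simp
    rw [← LinearMap.comp_assoc _ _ (LinearMap.rTensor M.carrier _), ← LinearMap.rTensor_comp,
      ← f.map_comp_comul, LinearMap.rTensor_comp, LinearMap.comp_assoc, ← LinearMap.comp_assoc,
      hs, LinearMap.comp_assoc, LinearMap.comp_assoc, M.coact_coassoc,
      ← LinearMap.comp_assoc _ _ (LinearMap.lTensor D _), LinearMap.lTensor_comp_rTensor,
      ← LinearMap.rTensor_comp_lTensor, LinearMap.lTensor_comp, LinearMap.comp_assoc,
      LinearMap.comp_assoc]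
  coact_counit := by
    rw [← LinearMap.comp_assoc _ _ (LinearMap.rTensor _ _), ← LinearMap.rTensor_comp,
      f.counit_comp, M.coact_counit]

end

end LeftComod

/-- A right comodule is finitely cogenerated if it embeds into `Cⁿ` for some natural number `n`. -/
def RightComod.FinitelyCogenerated {K : Type u} [Field K] {C : Type v} [AddCommGroup C]
    [Module K C] [Coalgebra K C] (M : RightComod.{u, v, v} K C) : Prop :=
  ∃ (n : ℕ) (f : M ⟶ RightComod.power K C n), Function.Injective f.toLin

/-- A left comodule is finitely cogenerated if it embeds into `Cⁿ` for some natural number `n`. -/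
def LeftComod.FinitelyCogenerated {K : Type u} [Field K] {C : Type v} [AddCommGroup C]
    [Module K C] [Coalgebra K C] (M : LeftComod.{u, v, v} K C) : Prop :=
  ∃ (n : ℕ) (f : M ⟶ LeftComod.power K C n), Function.Injective f.toLin

/-! ### Frobenius functors and Frobenius extensions -/

/-- A functor is Frobenius if it has a left adjoint and a right adjoint which are naturally
isomorphic. -/
def IsFrobeniusFunctor {𝒜 : Type*} [Category 𝒜] {ℬ : Type*} [Category ℬ] (U : 𝒜 ⥤ ℬ) : Prop :=
  ∃ L R : ℬ ⥤ 𝒜, Nonempty (L ⊣ U) ∧ Nonempty (U ⊣ R) ∧ Nonempty (L ≅ R)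

/-- A coalgebra map `f : C → D` is a Frobenius extension of coalgebras if the corestriction functor
from right `C`-comodules to right `D`-comodules is a Frobenius functor. -/
def IsFrobeniusCoalgExt {K : Type u} [Field K] {C D : Type v} [AddCommGroup C] [Module K C]
    [Coalgebra K C] [AddCommGroup D] [Module K D] [Coalgebra K D] (f : C →ₗc[K] D) : Prop :=
  IsFrobeniusFunctor (RightComod.corestrict.{u, v, v} f)

/-- `B` is finitely generated as a left `A`-module along the ring map `φ : A → B`,
`a • b = φ a * b`. -/
def LeftModuleFinite {A B : Type*} [Ring A] [Ring B] (φ : A →+* B) : Prop :=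
  letI : Module A B := Module.compHom B φ
  Module.Finite A B

/-- `B` is finitely generated as a right `A`-module along the ring map `φ : A → B`,
`b • a = b * φ a`; right modules are left modules over the opposite ring. -/
def RightModuleFinite {A B : Type*} [Ring A] [Ring B] (φ : A →+* B) : Prop :=
  letI : Module Aᵐᵒᵖ B := Module.compHom B φ.op
  Module.Finite Aᵐᵒᵖ B

/-- A ring map `φ : A → B` is a Frobenius extension if `B` is a finitely generated projective left
`A`-module and `B ≃ Hom_A(B, A)` as `(B, A)`-bimodules. Here `Hom_A(B, A)` is the group of left
`A`-linear maps, with the actions `(b • g) x = g (x * b)` and `(g • a) x = g x * a`, while the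
actions on `B` are `b • b' = b * b'` and `b' • a = b' * φ a`. -/
def IsFrobeniusRingExt {A B : Type*} [Ring A] [Ring B] (φ : A →+* B) : Prop :=
  letI : Module A B := Module.compHom B φ
  Module.Finite A B ∧ Module.Projective A B ∧
    ∃ Φ : B ≃+ (B →ₗ[A] A),
      (∀ b b' x : B, Φ (b * b') x = Φ b' (x * b)) ∧
      (∀ (b' : B) (a : A) (x : B), Φ (b' * φ a) x = Φ b' x * a)

/-! ### The dual algebra -/

section

variable {K : Type u} [Field K] {C D : Type v} [AddCommGroup C] [Module K C] [Coalgebra K C]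
  [AddCommGroup D] [Module K D] [Coalgebra K D]

variable (K C) in
/-- The dual algebra `C* = Hom_K(C, K)` of a coalgebra, with the convolution product
`(g * h) c = g c₁ * h c₂` and unit the counit of `C`. -/
abbrev DualAlg : Type (max v u) := WithConv (C →ₗ[K] K)

/-- The algebra map `f* : D* → C*`, `g ↦ g ∘ f`, dual to a coalgebra map `f : C → D`. -/
def dualAlgMap (f : C →ₗc[K] D) : DualAlg K D →+* DualAlg K C where
  toFun g := WithConv.toConv (g.ofConv ∘ₗ f.toLinearMap)
  map_one' := by
    ext c
    simp
  map_mul' g h := by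
    ext c
    exact LinearMap.congr_fun (LinearMap.convMul_comp_coalgHom_distrib g h f) c
  map_zero' := by
    rfl
  map_add' g h := by
    rfl

end

end

/-! A right `C`-comodule is a left `C*`-module through `b • m = b(m₁) m₀`. A tensor in `M ⊗ C` is
determined by its slices, its contractions with functionals on `C` (`rightSlice_ext`), so comodule
morphisms are exactly the `C*`-linear maps and subcomodules are the `C*`-stable subspaces. If `C` is
finite dimensional then `M ⊗ C = Hom_K(C*, M)` (`sliceEquiv`), every `C*`-module is a comodule, and
corestriction is restriction of scalars along `φ = λ*`. Both conditions then amount to a Frobenius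
system: a `D*`-bimodule map `E : C* → D*` with dual bases `x`, `y`.

Finite dimension of `C` has to be earned. On the ring side, `C*` is finitely generated over the
finite-dimensional `D*`. On the coalgebra side, let `F` be the two-sided adjoint. As a left adjoint
it sends finite-dimensional comodules to finite-dimensional ones, because `F N` is generated by the
image of the unit and each cyclic submodule `C* m` is finite dimensional. As a right adjoint it has
a value `F D` into which `C` embeds.

From `F` to a system: with `η` the unit of the first adjunction and `ε` the counit of the second,
put `u = η(1)` in `F(D*)` and `E(b) = ε(b u)`. Naturality gives `ε(b η(n)) = E(b) n` for every `N`,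
and the dual bases are read off the element `δ(1)`, where `δ : C* → F(C*)` is the unit of the second
adjunction (`nonempty_frobeniusSystem_of_adjunctions`).

Conversely, coinduction `N ↦ Hom_{D*}(C*, N)`, realised as the cotensor product, is always right
adjoint to corestriction when `C` is finite dimensional. A system makes it left adjoint too, with
unit `n ↦ (z ↦ E(z) n)` (`coindCorestrictAdjunction`). The dual bases also average linear
retractions into colinear extensions, which gives injectivity on both sides. -/

noncomputable section

/-! ### Slices of tensors -/

section Slice

variable {K : Type u} [Field K] {C : Type v} [AddCommGroup C] [Module K C]
  {M : Type w} [AddCommGroup M] [Module K M] {N : Type*} [AddCommGroup N] [Module K N]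

variable (C M) in
/-- Contraction of the right factor of `M ⊗ C` with a functional. -/
def rightSlice : DualAlg K C →ₗ[K] M ⊗[K] C →ₗ[K] M :=
  LinearMap.compRight K (TensorProduct.rid K M).toLinearMap ∘ₗ LinearMap.lTensorHom M ∘ₗ
    (WithConv.linearEquiv K (C →ₗ[K] K)).toLinearMap

@[simp]
lemma rightSlice_tmul (b : DualAlg K C) (m : M) (c : C) :
    rightSlice C M b (m ⊗ₜ c) = b c • m := by
  simp [rightSlice]

variable (C M) in
/-- Contraction of the left factor of `C ⊗ M` with a functional. -/
def leftSlice (b : DualAlg K C) : C ⊗[K] M →ₗ[K] M :=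
  rightSlice C M b ∘ₗ (TensorProduct.comm K C M).toLinearMap

@[simp]
lemma leftSlice_tmul (b : DualAlg K C) (m : M) (c : C) :
    leftSlice C M b (c ⊗ₜ m) = b c • m := by
  simp [leftSlice]

lemma rightSlice_rTensor (g : M →ₗ[K] N) (b : DualAlg K C) (t : M ⊗[K] C) :
    rightSlice C N b (g.rTensor C t) = g (rightSlice C M b t) := by
  induction t with
  | zero => simp
  | tmul m c => simp
  | add s t hs ht => simp only [map_add, hs, ht]

lemma leftSlice_lTensor (g : M →ₗ[K] N) (b : DualAlg K C) (t : C ⊗[K] M) :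
    leftSlice C N b (g.lTensor C t) = g (leftSlice C M b t) := by
  induction t with
  | zero => simp
  | tmul m c => simp
  | add s t hs ht => simp only [map_add, hs, ht]

lemma eq_of_forall_dualAlg_apply {c c' : C} (h : ∀ b : DualAlg K C, b c = b c') : c = c' :=
  sub_eq_zero.1 <| (Module.forall_dual_apply_eq_zero_iff K _).1 fun b => by
    rw [map_sub, sub_eq_zero]
    exact h (WithConv.toConv b)

/-- The coordinate functionals of a basis, as elements of the dual algebra. -/
def dualCoord {ι : Type*} (e : Module.Basis ι K C) (i : ι) : DualAlg K C :=
  WithConv.toConv (e.coord i)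

/-- Turns statements about all slices into statements about coordinates along a basis of `C`,
without any finiteness of `C`. -/
lemma equivFinsuppOfBasisRight_eq_rightSlice {ι : Type*} [DecidableEq ι] (e : Module.Basis ι K C)
    (t : M ⊗[K] C) (i : ι) :
    TensorProduct.equivFinsuppOfBasisRight e t i = rightSlice C M (dualCoord e i) t := by
  induction t with
  | zero => simp
  | tmul m c => simp [dualCoord]
  | add s t hs ht => simp only [map_add, hs, ht, Finsupp.add_apply]

lemma rightSlice_ext {s t : M ⊗[K] C} (h : ∀ b, rightSlice C M b s = rightSlice C M b t) :
    s = t := by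
  classical
  let e := Module.Free.chooseBasis K C
  apply (TensorProduct.equivFinsuppOfBasisRight e).injective
  ext i
  simp only [equivFinsuppOfBasisRight_eq_rightSlice, h]

lemma leftSlice_ext {s t : C ⊗[K] M} (h : ∀ b, leftSlice C M b s = leftSlice C M b t) :
    s = t :=
  (TensorProduct.comm K C M).injective (rightSlice_ext h)

/-- Expanding `t` along a basis of `C`, the coefficients are slices and so lie in `W`. This is what
makes a `C*`-stable subspace a subcomodule. -/
lemma mem_range_rTensor_of_rightSlice_mem (W : Submodule K M) {t : M ⊗[K] C}
    (h : ∀ b, rightSlice C M b t ∈ W) : t ∈ LinearMap.range (W.subtype.rTensor C) := by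
  classical
  let e := Module.Free.chooseBasis K C
  rw [← (TensorProduct.equivFinsuppOfBasisRight e).symm_apply_apply t,
    TensorProduct.equivFinsuppOfBasisRight_symm_apply]
  refine Submodule.sum_mem _ fun i _ => ⟨⟨_, h (dualCoord e i)⟩ ⊗ₜ e i, ?_⟩
  simp [equivFinsuppOfBasisRight_eq_rightSlice]

lemma mem_range_lTensor_of_leftSlice_mem (W : Submodule K M) {t : C ⊗[K] M}
    (h : ∀ b, leftSlice C M b t ∈ W) : t ∈ LinearMap.range (W.subtype.lTensor C) := by
  obtain ⟨s, hs⟩ := mem_range_rTensor_of_rightSlice_mem W h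
  refine ⟨TensorProduct.comm K W C s, (TensorProduct.comm K C M).injective ?_⟩
  refine Eq.trans ?_ hs
  clear hs
  induction s with
  | zero => simp
  | tmul m c => simp
  | add s t hs ht => simp only [map_add, hs, ht]

lemma exists_rightSlice_eq [FiniteDimensional K C] (T : DualAlg K C →ₗ[K] M) :
    ∃ t : M ⊗[K] C, ∀ b, rightSlice C M b t = T b := by
  classical
  let e := Module.finBasis K C
  refine ⟨∑ i, T (dualCoord e i) ⊗ₜ e i, fun b => ?_⟩
  rw [map_sum]
  simp_rw [rightSlice_tmul, ← map_smul]
  rw [← map_sum]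
  congr 1
  ext1
  rw [WithConv.ofConv_sum]
  exact e.sum_dual_apply_smul_coord b.ofConv

variable (C M) in
/-- For finite-dimensional `C`, tensors in `M ⊗ C` are the linear maps `C* → M`. -/
def sliceEquiv [FiniteDimensional K C] : M ⊗[K] C ≃ₗ[K] (DualAlg K C →ₗ[K] M) :=
  LinearEquiv.ofBijective (rightSlice C M).flip
    ⟨fun _ _ h => rightSlice_ext fun b => LinearMap.congr_fun h b,
      fun T => (exists_rightSlice_eq T).imp fun _ h => LinearMap.ext h⟩

@[simp]
lemma sliceEquiv_apply [FiniteDimensional K C] (t : M ⊗[K] C) (b : DualAlg K C) :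
    sliceEquiv C M t b = rightSlice C M b t := rfl

@[simp]
lemma rightSlice_sliceEquiv_symm [FiniteDimensional K C] (T : DualAlg K C →ₗ[K] M)
    (b : DualAlg K C) : rightSlice C M b ((sliceEquiv C M).symm T) = T b := by
  rw [← sliceEquiv_apply, LinearEquiv.apply_symm_apply]

/-- A tensor is a finite sum of pure tensors, each with slices on a line. Applied to a coaction,
this is local finiteness: `C* m` is finite dimensional even when `C` is not. -/
lemma finiteDimensional_range_rightSlice (t : M ⊗[K] C) :
    FiniteDimensional K (LinearMap.range ((rightSlice C M).flip t)) := by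
  induction t with
  | zero => rw [map_zero, LinearMap.range_zero]; infer_instance
  | tmul m c =>
    refine Submodule.finiteDimensional_of_le (S₂ := Submodule.span K {m}) ?_
    rintro _ ⟨b, rfl⟩
    exact Submodule.mem_span_singleton.2 ⟨b c, by simp⟩
  | add s t hs ht =>
    refine Submodule.finiteDimensional_of_le
      (S₂ := LinearMap.range ((rightSlice C M).flip s) ⊔ LinearMap.range ((rightSlice C M).flip t))
      ?_
    rw [map_add]
    exact LinearMap.range_add_le _ _

lemma mul_apply_tmul [Coalgebra K C] (g h : DualAlg K C) (c : C) (m : M) :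
    rightSlice C M (g * h) (m ⊗ₜ c) =
      rightSlice C M g (rightSlice C (M ⊗[K] C) h
        ((TensorProduct.assoc K M C C).symm (m ⊗ₜ Coalgebra.comul c))) := by
  rw [rightSlice_tmul, LinearMap.convMul_apply]
  induction (Coalgebra.comul (R := K) c) with
  | zero => simp
  | tmul x y => simp [mul_smul, smul_comm (h y)]
  | add s t hs ht => simp only [map_add, TensorProduct.tmul_add, add_smul, hs, ht]

/-- The functional `h` contracts the last factor first, so coassociativity will give a left action
of `C*`. -/
lemma rightSlice_mul [Coalgebra K C] (g h : DualAlg K C) (t : M ⊗[K] C) :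
    rightSlice C M (g * h) t =
      rightSlice C M g (rightSlice C (M ⊗[K] C) h ((TensorProduct.assoc K M C C).symm
        ((Coalgebra.comul (R := K) (A := C)).lTensor M t))) := by
  induction t with
  | zero => simp
  | tmul m c => rw [mul_apply_tmul, LinearMap.lTensor_tmul]
  | add s t hs ht => simp only [map_add, hs, ht]

/-- Here `g` contracts the outermost factor first, so left comodules become right modules. -/
lemma leftSlice_mul [Coalgebra K C] (g h : DualAlg K C) (t : C ⊗[K] M) :
    leftSlice C M (g * h) t =
      leftSlice C M h (leftSlice C (C ⊗[K] M) g (TensorProduct.assoc K C C M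
        ((Coalgebra.comul (R := K) (A := C)).rTensor M t))) := by
  induction t with
  | zero => simp
  | tmul c m =>
    rw [leftSlice_tmul, LinearMap.convMul_apply, LinearMap.rTensor_tmul]
    induction (Coalgebra.comul (R := K) c) with
    | zero => simp
    | tmul x y => simp [mul_smul]
    | add s t hs ht => simp only [map_add, TensorProduct.add_tmul, add_smul, hs, ht]
  | add s t hs ht => simp only [map_add, hs, ht]

lemma rightSlice_one [Coalgebra K C] (t : M ⊗[K] C) :
    rightSlice C M 1 t =
      TensorProduct.rid K M ((Coalgebra.counit (R := K) (A := C)).lTensor M t) := by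
  induction t with
  | zero => simp
  | tmul m c => simp
  | add s t hs ht => simp only [map_add, hs, ht]

lemma leftSlice_one [Coalgebra K C] (t : C ⊗[K] M) :
    leftSlice C M 1 t =
      TensorProduct.lid K M ((Coalgebra.counit (R := K) (A := C)).rTensor M t) := by
  induction t with
  | zero => simp
  | tmul m c => simp
  | add s t hs ht => simp only [map_add, hs, ht]

end Slice

/-! ### Slices along a coalgebra map -/

section DualAlgMap

variable {K : Type u} [Field K] {C D : Type v} [AddCommGroup C] [Module K C] [Coalgebra K C]
  [AddCommGroup D] [Module K D] [Coalgebra K D] (f : C →ₗc[K] D)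

@[simp]
lemma dualAlgMap_apply (a : DualAlg K D) (c : C) : dualAlgMap f a c = a (f c) := rfl

lemma dualAlgMap_smul (k : K) (a : DualAlg K D) : dualAlgMap f (k • a) = k • dualAlgMap f a := rfl

lemma rightSlice_lTensor {M : Type*} [AddCommGroup M] [Module K M] (a : DualAlg K D)
    (t : M ⊗[K] C) :
    rightSlice D M a (f.toLinearMap.lTensor M t) = rightSlice C M (dualAlgMap f a) t := by
  induction t with
  | zero => simp
  | tmul m c => simp
  | add s t hs ht => simp only [map_add, hs, ht]

lemma leftSlice_rTensor {M : Type*} [AddCommGroup M] [Module K M] (a : DualAlg K D)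
    (t : C ⊗[K] M) :
    leftSlice D M a (f.toLinearMap.rTensor M t) = leftSlice C M (dualAlgMap f a) t := by
  induction t with
  | zero => simp
  | tmul m c => simp
  | add s t hs ht => simp only [map_add, hs, ht]

end DualAlgMap

/-! ### The action of the dual algebra on a comodule -/

namespace RightComod

variable {K : Type u} [Field K] {C : Type v} [AddCommGroup C] [Module K C] [Coalgebra K C]

/-- The left action `b • m = b(m₁) m₀` of the dual algebra on a right comodule. -/
def act (M : RightComod.{u, v, w} K C) : DualAlg K C →ₗ[K] M.carrier →ₗ[K] M.carrier :=
  LinearMap.lcomp K M.carrier M.coact ∘ₗ rightSlice C M.carrier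

lemma act_apply (M : RightComod.{u, v, w} K C) (b : DualAlg K C) (m : M.carrier) :
    M.act b m = rightSlice C M.carrier b (M.coact m) := rfl

lemma act_one (M : RightComod.{u, v, w} K C) (m : M.carrier) : M.act 1 m = m := by
  rw [act_apply, rightSlice_one]
  exact LinearMap.congr_fun M.coact_counit m

lemma act_mul (M : RightComod.{u, v, w} K C) (g h : DualAlg K C) (m : M.carrier) :
    M.act (g * h) m = M.act g (M.act h m) := by
  have hc := LinearMap.congr_fun M.coact_coassoc m
  simp only [LinearMap.comp_apply] at hc
  rw [act_apply, rightSlice_mul, ← hc]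
  simp only [LinearEquiv.coe_coe, LinearEquiv.symm_apply_apply]
  rw [rightSlice_rTensor]
  rfl

lemma Hom.act {M N : RightComod.{u, v, w} K C} (g : M ⟶ N) (b : DualAlg K C) (m : M.carrier) :
    g.toLin (M.act b m) = N.act b (g.toLin m) := by
  have hc := LinearMap.congr_fun g.comm m
  simp only [LinearMap.comp_apply] at hc
  rw [act_apply, act_apply, ← hc, rightSlice_rTensor]

@[simp]
lemma id_toLin (M : RightComod.{u, v, w} K C) (m : M.carrier) : (𝟙 M : M ⟶ M).toLin m = m := rfl

@[simp]
lemma comp_toLin {M N P : RightComod.{u, v, w} K C} (g : M ⟶ N) (h : N ⟶ P) (m : M.carrier) :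
    (g ≫ h).toLin m = h.toLin (g.toLin m) := rfl

lemma hom_ext {M N : RightComod.{u, v, w} K C} {g h : M ⟶ N}
    (H : ∀ m, g.toLin m = h.toLin m) : g = h :=
  Hom.ext (LinearMap.ext H)

/-- A linear map commuting with the actions of the dual algebra is a morphism of comodules. -/
def homOfAct {M N : RightComod.{u, v, w} K C} (g : M.carrier →ₗ[K] N.carrier)
    (h : ∀ b m, g (M.act b m) = N.act b (g m)) : M ⟶ N where
  toLin := g
  comm := LinearMap.ext fun m => rightSlice_ext fun b => by
    simp only [LinearMap.comp_apply]
    rw [rightSlice_rTensor, ← act_apply, h, act_apply]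

@[simp]
lemma homOfAct_toLin {M N : RightComod.{u, v, w} K C} (g : M.carrier →ₗ[K] N.carrier) (h) :
    (homOfAct (M := M) (N := N) g h).toLin = g := rfl

/-- A coaction is determined by, and may be checked on, its slices. -/
abbrev ofSlice {V : Type w} [AddCommGroup V] [Module K V] (ρ : V →ₗ[K] V ⊗[K] C)
    (h_one : ∀ v, rightSlice C V 1 (ρ v) = v)
    (h_mul : ∀ g h v, rightSlice C V (g * h) (ρ v) =
      rightSlice C V g (ρ (rightSlice C V h (ρ v)))) : RightComod.{u, v, w} K C where
  carrier := V
  coact := ρ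
  coact_coassoc := LinearMap.ext fun v => by
    simp only [LinearMap.comp_apply, LinearEquiv.coe_coe]
    rw [← LinearEquiv.eq_symm_apply]
    refine rightSlice_ext fun h => rightSlice_ext fun g => ?_
    rw [← rightSlice_mul, rightSlice_rTensor, h_mul]
  coact_counit := LinearMap.ext fun v => by
    simp only [LinearMap.comp_apply, LinearEquiv.coe_coe, LinearMap.id_apply]
    rw [← rightSlice_one, h_one]

/-- The restriction of the coaction to a subspace stable under the action of the dual algebra. -/
def subCoact (M : RightComod.{u, v, w} K C) (W : Submodule K M.carrier)
    (hW : ∀ b, ∀ m ∈ W, M.act b m ∈ W) : W →ₗ[K] W ⊗[K] C :=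
  (LinearEquiv.ofInjective (W.subtype.rTensor C)
    (Module.Flat.rTensor_preserves_injective_linearMap _ W.injective_subtype)).symm.toLinearMap ∘ₗ
    LinearMap.codRestrict _ (M.coact ∘ₗ W.subtype)
      fun m => mem_range_rTensor_of_rightSlice_mem W fun b => hW b m m.2

lemma rightSlice_subCoact (M : RightComod.{u, v, w} K C) (W : Submodule K M.carrier) (hW)
    (b : DualAlg K C) (m : W) :
    (rightSlice C W b (M.subCoact W hW m) : M.carrier) = M.act b m := by
  have h1 : W.subtype.rTensor C (M.subCoact W hW m) = M.coact m :=
    congrArg Subtype.val (LinearEquiv.apply_symm_apply (LinearEquiv.ofInjective (W.subtype.rTensor C)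
      (Module.Flat.rTensor_preserves_injective_linearMap _ W.injective_subtype)) _)
  rw [act_apply, ← h1, rightSlice_rTensor]
  rfl

/-- The subcomodule carried by a subspace stable under the action of the dual algebra. -/
abbrev sub (M : RightComod.{u, v, w} K C) (W : Submodule K M.carrier)
    (hW : ∀ b, ∀ m ∈ W, M.act b m ∈ W) : RightComod.{u, v, w} K C :=
  ofSlice (M.subCoact W hW) (fun v => Subtype.ext (by rw [rightSlice_subCoact, act_one]))
    fun g h v => Subtype.ext (by
      rw [rightSlice_subCoact, act_mul, rightSlice_subCoact, rightSlice_subCoact])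

lemma sub_act (M : RightComod.{u, v, w} K C) (W : Submodule K M.carrier) (hW)
    (b : DualAlg K C) (m : W) : W.subtype ((M.sub W hW).act b m) = M.act b m :=
  M.rightSlice_subCoact W hW b m

/-- The inclusion of a subcomodule. -/
def subIncl (M : RightComod.{u, v, w} K C) (W : Submodule K M.carrier) (hW) : M.sub W hW ⟶ M :=
  homOfAct (M := M.sub W hW) W.subtype fun b m => M.sub_act W hW b m

/-- The comodule over a finite-dimensional coalgebra defined by a representation of the dual
algebra. -/
def ofAct [FiniteDimensional K C] {V : Type w} [AddCommGroup V] [Module K V]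
    (ρ : DualAlg K C →ₗ[K] V →ₗ[K] V) (h_one : ∀ v, ρ 1 v = v)
    (h_mul : ∀ g h v, ρ (g * h) v = ρ g (ρ h v)) : RightComod.{u, v, w} K C :=
  ofSlice ((sliceEquiv C V).symm.toLinearMap ∘ₗ ρ.flip) (by simp [h_one]) (by simp [h_mul])

lemma ofAct_act [FiniteDimensional K C] {V : Type w} [AddCommGroup V] [Module K V]
    (ρ : DualAlg K C →ₗ[K] V →ₗ[K] V) (h_one) (h_mul) (b : DualAlg K C) (v : V) :
    (ofAct ρ h_one h_mul).act b v = ρ b v :=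
  rightSlice_sliceEquiv_symm (ρ.flip v) b

lemma counit_act_regular (b : DualAlg K C) (c : C) :
    Coalgebra.counit (R := K) ((regular K C).act b c) = b c := by
  have h := LinearMap.congr_fun (Coalgebra.rTensor_counit_comp_comul (R := K) (A := C)) c
  have h2 := rightSlice_rTensor (C := C) (Coalgebra.counit (R := K) (A := C)) b
    (Coalgebra.comul (R := K) c)
  rw [act_apply, ← h2]
  simp only [LinearMap.comp_apply] at h
  rw [h]
  simp

variable {D : Type v} [AddCommGroup D] [Module K D] [Coalgebra K D] (f : C →ₗc[K] D)

/-- In terms of modules, corestriction is restriction of scalars along `λ*`. -/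
lemma corestrictObj_act (M : RightComod.{u, v, w} K C) (a : DualAlg K D) (m : M.carrier) :
    (corestrictObj f M).act a m = M.act (dualAlgMap f a) m :=
  rightSlice_lTensor f a (M.coact m)

variable (K C) in
/-- A linear identification of a finite-dimensional coalgebra with its dual algebra. -/
def toDualAlg [FiniteDimensional K C] : C ≃ₗ[K] DualAlg K C :=
  (Module.finBasis K C).toDualEquiv ≪≫ₗ (WithConv.linearEquiv K (C →ₗ[K] K)).symm

variable (K C) in
/-- The dual algebra of a finite-dimensional coalgebra as a comodule, corresponding to the left
regular representation. -/
def dual [FiniteDimensional K C] : RightComod.{u, v, v} K C :=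
  -- The carrier is `C` with the structure transported from `C*`: the dual may live in a larger
  -- universe than the comodules considered.
  ofAct (V := C)
    ((LinearMap.lcomp K C (toDualAlg K C).toLinearMap) ∘ₗ
      (LinearMap.compRight K (toDualAlg K C).symm.toLinearMap) ∘ₗ
      LinearMap.mul K (DualAlg K C))
    (fun v => by simp) (fun g h v => by simp [mul_assoc])

/-- The comodule `dual K C` has the dual algebra as underlying space. -/
def dualEquiv [FiniteDimensional K C] : (dual K C).carrier ≃ₗ[K] DualAlg K C := toDualAlg K C

lemma dualEquiv_act [FiniteDimensional K C] (b : DualAlg K C) (m : (dual K C).carrier) :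
    dualEquiv ((dual K C).act b m) = b * dualEquiv m := by
  have h : (dual K C).act b m = (toDualAlg K C).symm (b * toDualAlg K C m) := ofAct_act _ _ _ b m
  rw [h]
  exact (toDualAlg K C).apply_symm_apply _

/-- The morphism from the regular representation determined by an element. -/
def dualHom [FiniteDimensional K C] (M : RightComod.{u, v, v} K C) (m : M.carrier) :
    dual K C ⟶ M :=
  homOfAct (M.act.flip m ∘ₗ dualEquiv.toLinearMap) fun b x => by
    simp [dualEquiv_act, act_mul]

@[simp]
lemma dualHom_apply [FiniteDimensional K C] (M : RightComod.{u, v, v} K C) (m : M.carrier)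
    (x : (dual K C).carrier) : (dualHom M m).toLin x = M.act (dualEquiv x) m := rfl

/-- The kernel is `C*`-stable, hence a subcomodule; its inclusion and the zero map agree after `g`,
so they are equal. -/
lemma injective_of_mono {M N : RightComod.{u, v, w} K C} (g : M ⟶ N) [Mono g] :
    Function.Injective g.toLin := by
  rw [← LinearMap.ker_eq_bot]
  have hW (b : DualAlg K C) : ∀ m ∈ LinearMap.ker g.toLin, M.act b m ∈ LinearMap.ker g.toLin := by
    intro m hm
    rw [LinearMap.mem_ker] at hm ⊢
    rw [g.act, hm, map_zero]
  have h : M.subIncl _ hW = homOfAct 0 (by simp) := by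
    rw [← cancel_mono g]
    refine hom_ext fun m => ?_
    have hm : g.toLin (Submodule.subtype _ m) = 0 := m.2
    exact hm.trans (map_zero g.toLin).symm
  rw [eq_bot_iff]
  intro m hm
  exact LinearMap.congr_fun (congrArg Hom.toLin h) (⟨m, hm⟩ : LinearMap.ker g.toLin)

/-- The action on `C` is the transpose of right multiplication on `C*`, since any functional is
recovered as `b(c) = ε(b • c)`. -/
lemma apply_act_regular (b b' : DualAlg K C) (c : C) : b' ((regular K C).act b c) = (b' * b) c := by
  rw [← counit_act_regular (b' * b), ← counit_act_regular b', act_mul]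

end RightComod

/-! ### Frobenius systems -/

/-- A Frobenius system for a ring map `φ : A → B`: an `A`-bimodule map `E : B → A` together with
dual bases `x`, `y`. -/
structure FrobeniusSystem {A B : Type*} [Ring A] [Ring B] (φ : A →+* B) where
  /-- the Frobenius homomorphism -/
  E : B →+ A
  map_left : ∀ a z, E (φ a * z) = a * E z
  map_right : ∀ z a, E (z * φ a) = E z * a
  /-- the size of the dual bases -/
  n : ℕ
  /-- the first dual basis -/
  x : Fin n → B
  /-- the second dual basis -/
  y : Fin n → B
  sum_left : ∀ z, ∑ i, φ (E (z * x i)) * y i = z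
  sum_right : ∀ z, ∑ i, x i * φ (E (y i * z)) = z

namespace FrobeniusSystem

variable {A B : Type*} [Ring A] [Ring B] {φ : A →+* B}

/-- One dual basis property and nondegeneracy imply the other dual basis property. -/
def ofNondegenerate (E : B →+ A) (map_left : ∀ a z, E (φ a * z) = a * E z)
    (map_right : ∀ z a, E (z * φ a) = E z * a) {n : ℕ} (x y : Fin n → B)
    (sum_left : ∀ z, ∑ i, φ (E (z * x i)) * y i = z)
    (nondeg : ∀ b, (∀ z, E (z * b) = 0) → b = 0) : FrobeniusSystem φ where
  E := E
  map_left := map_left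
  map_right := map_right
  n := n
  x := x
  y := y
  sum_left := sum_left
  sum_right z := by
    rw [← sub_eq_zero]
    -- Tested against `E (w * ·)`, both sides become `∑ E(w xᵢ) E(yᵢ z)`: the left by right
    -- linearity, the right by expanding `w` with `sum_left`.
    refine nondeg _ fun w => ?_
    rw [mul_sub, map_sub, sub_eq_zero, Finset.mul_sum, map_sum]
    conv_rhs => rw [← sum_left w, Finset.sum_mul, map_sum]
    refine Finset.sum_congr rfl fun i _ => ?_
    rw [← mul_assoc, map_right, mul_assoc, map_left]

/-- The first dual basis property splits `Aⁿ → B`, giving finite projectivity. The isomorphism is `b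
↦ E(· b)`, with inverse `β ↦ ∑ xᵢ φ(β(yᵢ))`. -/
lemma isFrobeniusRingExt (s : FrobeniusSystem φ) : IsFrobeniusRingExt φ := by
  let : Module A B := Module.compHom B φ
  have smul_def (a : A) (b : B) : a • b = φ a * b := rfl
  let p : (Fin s.n → A) →ₗ[A] B := Fintype.linearCombination A s.y
  let j : B →ₗ[A] (Fin s.n → A) :=
    { toFun := fun z i => s.E (z * s.x i)
      map_add' := fun z w => by ext; simp [add_mul]
      map_smul' := fun a z => by ext; simp [smul_def, mul_assoc, s.map_left] }
  have hpj : p ∘ₗ j = LinearMap.id := LinearMap.ext fun z => by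
    simpa [p, j, Fintype.linearCombination_apply, smul_def] using s.sum_left z
  have hp : Function.Surjective p := fun z => ⟨j z, LinearMap.congr_fun hpj z⟩
  refine ⟨Module.Finite.of_surjective p hp, Module.Projective.of_split j p hpj, ?_⟩
  let Φ : B →+ (B →ₗ[A] A) :=
    { toFun := fun b =>
        { toFun := fun z => s.E (z * b)
          map_add' := fun z w => by simp [add_mul]
          map_smul' := fun a z => by simp [smul_def, mul_assoc, s.map_left] }
      map_zero' := by ext; simp
      map_add' := fun b c => by ext; simp [mul_add] }
  have hΦ (b z : B) : Φ b z = s.E (z * b) := rfl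
  refine ⟨AddEquiv.ofBijective Φ ⟨?_, ?_⟩, fun b b' z => ?_, fun b' a z => ?_⟩
  · refine (injective_iff_map_eq_zero Φ).2 fun b hb => ?_
    rw [← s.sum_right b]
    refine Finset.sum_eq_zero fun i _ => ?_
    rw [← hΦ, hb]
    simp
  · intro β
    refine ⟨∑ i, s.x i * φ (β (s.y i)), LinearMap.ext fun z => ?_⟩
    conv_rhs => rw [← s.sum_left z, map_sum]
    rw [hΦ, Finset.mul_sum, map_sum]
    refine Finset.sum_congr rfl fun i _ => ?_
    rw [← mul_assoc, s.map_right, ← smul_def, map_smul, smul_eq_mul]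
  · change s.E (z * (b * b')) = s.E (z * b * b')
    rw [mul_assoc]
  · change s.E (z * (b' * φ a)) = s.E (z * b') * a
    rw [← mul_assoc, s.map_right]

end FrobeniusSystem

/-- Take `E = Φ 1`, so that `Φ b = E(· b)` and injectivity of `Φ` is nondegeneracy. A splitting of
`Aⁿ → B` provides generators `yᵢ` and coordinate forms, and the `xᵢ` represent these forms under
`Φ`. -/
lemma IsFrobeniusRingExt.nonempty_frobeniusSystem {A B : Type*} [Ring A] [Ring B] {φ : A →+* B}
    (h : IsFrobeniusRingExt φ) : Nonempty (FrobeniusSystem φ) := by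
  let : Module A B := Module.compHom B φ
  have smul_def (a : A) (b : B) : a • b = φ a * b := rfl
  obtain ⟨hfin, hproj, Φ, hΦ, hΦ'⟩ := h
  have E_eq (b z : B) : Φ b z = Φ 1 (z * b) := by rw [← hΦ, mul_one]
  obtain ⟨n, p, hp⟩ := Module.Finite.exists_fin' A B
  obtain ⟨j, hj⟩ := Module.projective_lifting_property p LinearMap.id hp
  let β (i : Fin n) : B →ₗ[A] A := LinearMap.proj i ∘ₗ j
  refine ⟨FrobeniusSystem.ofNondegenerate (Φ 1).toAddMonoidHom (fun a z => ?_) (fun z a => ?_)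
    (fun i => Φ.symm (β i)) (fun i => p (Pi.single i 1)) (fun z => ?_) fun b hb => ?_⟩
  · exact (Φ 1).map_smul a z
  · change Φ 1 (z * φ a) = Φ 1 z * a
    rw [← hΦ', one_mul, ← E_eq]
  · change ∑ i, φ (Φ 1 (z * Φ.symm (β i))) * p (Pi.single i 1) = z
    conv_rhs => rw [← LinearMap.id_apply (R := A) z, ← hj, LinearMap.comp_apply,
      LinearMap.pi_apply_eq_sum_univ p (j z)]
    refine Finset.sum_congr rfl fun i _ => ?_
    rw [← E_eq, Φ.apply_symm_apply, smul_def]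
    congr 2
    ext k
    simp [Pi.single_apply, eq_comm]
  · refine Φ.injective (LinearMap.ext fun z => ?_)
    rw [E_eq, map_zero]
    exact hb z

/-! ### Adjoints of the corestriction functor -/

namespace RightComod

variable {K : Type u} [Field K] {C D : Type v} [AddCommGroup C] [Module K C] [Coalgebra K C]
  [AddCommGroup D] [Module K D] [Coalgebra K D] {f : C →ₗc[K] D}

lemma Hom.act_corestrict {M : RightComod.{u, v, w} K C} {N : RightComod.{u, v, w} K D}
    (g : corestrictObj f M ⟶ N) (a : DualAlg K D) (m : M.carrier) :
    g.toLin (M.act (dualAlgMap f a) m) = N.act a (g.toLin m) := by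
  rw [← corestrictObj_act, g.act]

lemma Hom.act_to_corestrict {M : RightComod.{u, v, w} K C} {N : RightComod.{u, v, w} K D}
    (g : N ⟶ corestrictObj f M) (a : DualAlg K D) (n : N.carrier) :
    g.toLin (N.act a n) = M.act (dualAlgMap f a) (g.toLin n) := by
  rw [← corestrictObj_act, g.act]

/-- The values of a left adjoint of the corestriction functor are generated by the image of the
unit. -/
lemma mem_of_unit_mem {L : RightComod.{u, v, w} K D ⥤ RightComod.{u, v, w} K C}
    (adj : L ⊣ corestrict f) (N : RightComod.{u, v, w} K D) (W : Submodule K (L.obj N).carrier)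
    (hW : ∀ b, ∀ m ∈ W, (L.obj N).act b m ∈ W) (hη : ∀ n, (adj.unit.app N).toLin n ∈ W)
    (m : (L.obj N).carrier) : m ∈ W := by
  -- The unit factors through `W`; the transpose of this factorisation is a retraction of the
  -- inclusion of `W`, which forces `W` to be everything.
  let l : N ⟶ (corestrict f).obj ((L.obj N).sub W hW) :=
    homOfAct (N := corestrictObj f ((L.obj N).sub W hW))
      ((adj.unit.app N).toLin.codRestrict W hη) fun a n => Subtype.ext (by
        rw [corestrictObj_act]
        refine Eq.trans ?_ ((L.obj N).sub_act W hW _ _).symm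
        exact (adj.unit.app N).act_to_corestrict a n)
  let h : L.obj N ⟶ (L.obj N).sub W hW := (adj.homEquiv _ _).symm l
  have hh : h ≫ (L.obj N).subIncl W hW = 𝟙 _ := by
    apply (adj.homEquiv _ _).injective
    rw [adj.homEquiv_naturality_right, Equiv.apply_symm_apply, adj.homEquiv_id]
    rfl
  have := congrArg (fun g => Hom.toLin g m) hh
  rw [id_toLin] at this
  rw [← this]
  exact Subtype.property (h.toLin m : W)

/-- A left adjoint of the corestriction functor preserves finite-dimensionality. -/
lemma finiteDimensional_leftAdjoint {L : RightComod.{u, v, w} K D ⥤ RightComod.{u, v, w} K C}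
    (adj : L ⊣ corestrict f) (N : RightComod.{u, v, w} K D) [FiniteDimensional K N.carrier] :
    FiniteDimensional K (L.obj N).carrier := by
  let e := Module.finBasis K N.carrier
  let M := L.obj N
  let T (m : M.carrier) : Submodule K M.carrier := LinearMap.range (M.act.flip m)
  have hT (m : M.carrier) : FiniteDimensional K (T m) :=
    finiteDimensional_range_rightSlice (M.coact m)
  -- `W` is the subcomodule generated by the unit's values on a basis: finitely many cyclic pieces,
  -- each finite dimensional.
  let W : Submodule K M.carrier := ⨆ i, T ((adj.unit.app N).toLin (e i))
  have hle (i) : T ((adj.unit.app N).toLin (e i)) ≤ W :=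
    le_iSup (fun i => T ((adj.unit.app N).toLin (e i))) i
  have hW (b : DualAlg K C) : ∀ m ∈ W, M.act b m ∈ W := by
    suffices W ≤ W.comap (M.act b) from this
    refine iSup_le fun i => ?_
    rintro _ ⟨b', rfl⟩
    refine hle i ⟨b * b', ?_⟩
    rw [LinearMap.flip_apply, act_mul]
    rfl
  have hη (n : N.carrier) : (adj.unit.app N).toLin n ∈ W := by
    suffices ⊤ ≤ W.comap (adj.unit.app N).toLin from this trivial
    rw [← e.span_eq, Submodule.span_le]
    rintro _ ⟨i, rfl⟩
    exact hle i ⟨1, M.act_one _⟩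
  have htop : W = ⊤ := Submodule.eq_top_iff'.2 fun m => mem_of_unit_mem adj N W hW hη m
  have hfin : FiniteDimensional K W := Submodule.finiteDimensional_iSup _
  rw [htop] at hfin
  exact Module.Finite.equiv (Submodule.topEquiv (R := K) (M := M.carrier))

/-- The coalgebra `C` embeds into the value at `D` of a right adjoint of the corestriction
functor. -/
lemma exists_injective_rightAdjoint {R : RightComod.{u, v, v} K D ⥤ RightComod.{u, v, v} K C}
    (adj : corestrict f ⊣ R) :
    ∃ κ : C →ₗ[K] (R.obj (regular K D)).carrier, Function.Injective κ := by
  -- The coalgebra map itself is colinear over `D`; its transpose `κ` is the embedding.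
  let g : (corestrict f).obj (regular K C) ⟶ regular K D :=
    homOfAct (M := corestrictObj f (regular K C)) f.toLinearMap fun a c =>
      eq_of_forall_dualAlg_apply (K := K) fun a' => by
        rw [corestrictObj_act, apply_act_regular]
        change dualAlgMap f a' _ = _
        rw [apply_act_regular, ← map_mul]
        rfl
  let κ := adj.homEquiv _ _ g
  have hκ (c : C) : (adj.counit.app _).toLin (κ.toLin c) = f c := by
    have h : (corestrict f).map κ ≫ adj.counit.app _ = g :=
      (adj.homEquiv_counit _ _ κ).symm.trans (Equiv.symm_apply_apply _ _)
    exact congrArg (fun φ => Hom.toLin φ c) h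
  refine ⟨κ.toLin, (injective_iff_map_eq_zero _).2 fun c hc => ?_⟩
  refine eq_of_forall_dualAlg_apply (K := K) fun b => ?_
  -- `b(c)` is the counit of `D` at `f(b • c)`, and `f(b • c)` is the adjunction counit at `κ(b • c)
  -- = b • κ(c) = 0`.
  rw [map_zero, ← counit_act_regular, ← CoalgHomClass.counit_comp_apply f]
  have h := hκ ((regular K C).act b c)
  rw [κ.act, hc, map_zero, map_zero] at h
  erw [← h, map_zero]

end RightComod

/-- The right adjoint `R` is also a left adjoint, so `R D` is finite dimensional, and it contains a
copy of `C`. -/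
lemma IsFrobeniusCoalgExt.finiteDimensional {K : Type u} [Field K] {C D : Type v}
    [AddCommGroup C] [Module K C] [Coalgebra K C] [AddCommGroup D] [Module K D] [Coalgebra K D]
    [FiniteDimensional K D] {f : C →ₗc[K] D} (h : IsFrobeniusCoalgExt f) :
    FiniteDimensional K C := by
  obtain ⟨L, R, ⟨adj₁⟩, ⟨adj₂⟩, ⟨i⟩⟩ := h
  have : FiniteDimensional K (R.obj (RightComod.regular K D)).carrier :=
    RightComod.finiteDimensional_leftAdjoint (adj₁.ofNatIsoLeft i) _
  obtain ⟨κ, hκ⟩ := RightComod.exists_injective_rightAdjoint adj₂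
  exact FiniteDimensional.of_injective κ hκ

/-! ### From a two-sided adjoint to a Frobenius system -/

section System

open RightComod

variable {K : Type u} [Field K] {C D : Type v}
    [AddCommGroup C] [Module K C] [Coalgebra K C] [AddCommGroup D] [Module K D] [Coalgebra K D]
    [FiniteDimensional K C] [FiniteDimensional K D] {f : C →ₗc[K] D}

/-- A two-sided adjoint of the corestriction functor yields a Frobenius system. -/
lemma nonempty_frobeniusSystem_of_adjunctions
    {F : RightComod.{u, v, v} K D ⥤ RightComod.{u, v, v} K C}
    (adj₁ : F ⊣ corestrict f) (adj₂ : corestrict f ⊣ F) :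
    Nonempty (FrobeniusSystem (dualAlgMap f)) := by
  obtain ⟨η, hη⟩ : ∃ η : ∀ N, N ⟶ corestrictObj f (F.obj N), ∀ N, η N = adj₁.unit.app N :=
    ⟨_, fun _ => rfl⟩
  obtain ⟨ε, hε⟩ : ∃ ε : ∀ N, corestrictObj f (F.obj N) ⟶ N, ∀ N, ε N = adj₂.counit.app N :=
    ⟨_, fun _ => rfl⟩
  have η_nat {N N' : RightComod.{u, v, v} K D} (g : N ⟶ N') (n : N.carrier) :
      (F.map g).toLin ((η N).toLin n) = (η N').toLin (g.toLin n) := by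
    have h : g ≫ η N' = η N ≫ (corestrict f).map (F.map g) := by
      rw [hη, hη]
      exact adj₁.unit.naturality g
    exact (LinearMap.congr_fun (congrArg Hom.toLin h) n).symm
  have ε_nat {N N' : RightComod.{u, v, v} K D} (g : N ⟶ N') (m : (F.obj N).carrier) :
      g.toLin ((ε N).toLin m) = (ε N').toLin ((F.map g).toLin m) := by
    have h : (corestrict f).map (F.map g) ≫ ε N' = ε N ≫ g := by
      rw [hε, hε]
      exact adj₂.counit.naturality g
    exact (LinearMap.congr_fun (congrArg Hom.toLin h) m).symm
  have ε_inj {M : RightComod.{u, v, v} K C} {N : RightComod.{u, v, v} K D} (g : M ⟶ F.obj N)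
      (hg : ∀ m, (ε N).toLin (g.toLin m) = 0) (m : M.carrier) : g.toLin m = 0 := by
    have h : g = homOfAct 0 (by simp) := by
      apply (adj₂.homEquiv _ _).symm.injective
      rw [adj₂.homEquiv_counit, adj₂.homEquiv_counit, ← hε]
      exact hom_ext fun m => (hg m).trans (map_zero (ε N).toLin).symm
    rw [h]
    rfl
  have η_lift {N : RightComod.{u, v, v} K D} {M : RightComod.{u, v, v} K C}
      (g : N ⟶ corestrictObj f M) : ∃ k : F.obj N ⟶ M, ∀ n, k.toLin ((η N).toLin n) = g.toLin n := by
    refine ⟨(adj₁.homEquiv _ _).symm g, fun n => ?_⟩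
    have h : η N ≫ (corestrict f).map ((adj₁.homEquiv _ _).symm g) = g := by
      rw [hη, ← adj₁.homEquiv_unit, Equiv.apply_symm_apply]
    exact LinearMap.congr_fun (congrArg Hom.toLin h) n
  have ε_section (M : RightComod.{u, v, v} K C) :
      ∃ δ : M ⟶ F.obj (corestrictObj f M), ∀ m, (ε (corestrictObj f M)).toLin (δ.toLin m) = m := by
    refine ⟨adj₂.unit.app M, fun m => ?_⟩
    have h : (corestrict f).map (adj₂.unit.app M) ≫ ε (corestrictObj f M) = 𝟙 _ := by
      rw [hε]
      exact adj₂.left_triangle_components M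
    exact LinearMap.congr_fun (congrArg Hom.toLin h) m
  let u : (F.obj (dual K D)).carrier := (η (dual K D)).toLin (dualEquiv.symm 1)
  let E : DualAlg K C →ₗ[K] DualAlg K D :=
    dualEquiv.toLinearMap ∘ₗ (ε (dual K D)).toLin ∘ₗ (F.obj (dual K D)).act.flip u
  have E_apply (b : DualAlg K C) :
    E b = dualEquiv ((ε (dual K D)).toLin ((F.obj (dual K D)).act b u)) := rfl
  -- Naturality of `η` and `ε` along `D* → N`, `a ↦ a • n`, carries the definition of `E` from `D*`
  -- to every `N`.
  have ε_act_η (N : RightComod.{u, v, v} K D) (n : N.carrier) (b : DualAlg K C) :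
      (ε N).toLin ((F.obj N).act b ((η N).toLin n)) = N.act (E b) n := by
    have h1 : (η N).toLin n = (F.map (dualHom N n)).toLin u := by
      rw [η_nat, dualHom_apply, LinearEquiv.apply_symm_apply, act_one]
    rw [h1, ← (F.map (dualHom N n)).act, ← ε_nat, dualHom_apply, E_apply]
  have E_left (a : DualAlg K D) (z : DualAlg K C) : E (dualAlgMap f a * z) = a * E z := by
    rw [E_apply, act_mul, (ε (dual K D)).act_corestrict, dualEquiv_act, E_apply]
  have E_right (z : DualAlg K C) (a : DualAlg K D) : E (z * dualAlgMap f a) = E z * a := by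
    -- Colinearity of `η` moves `a` inside: `φ(a) u = η(a)`, to which `ε_act_η` applies.
    have h1 : (F.obj (dual K D)).act (dualAlgMap f a) u =
        (η (dual K D)).toLin (dualEquiv.symm a) := by
      rw [← (η (dual K D)).act_to_corestrict]
      congr 1
      apply dualEquiv.injective
      rw [dualEquiv_act]
      simp
    rw [E_apply, act_mul, h1, ε_act_η, dualEquiv_act, LinearEquiv.apply_symm_apply]
  have nondeg (b : DualAlg K C) (hb : ∀ z, E (z * b) = 0) : b = 0 := by
    -- The morphism `z ↦ z (b u)` from `C*` is killed by `ε`, hence zero by right adjointness. Left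
    -- adjointness then yields a morphism `k` with `k(u) = 1`, so `b = k(b u) = 0`.
    have hu : (F.obj (dual K D)).act b u = 0 := by
      have h := ε_inj (dualHom _ ((F.obj (dual K D)).act b u)) (fun m => dualEquiv.injective (by
        rw [dualHom_apply, ← act_mul, ← E_apply, hb, map_zero])) (dualEquiv.symm 1)
      rwa [dualHom_apply, LinearEquiv.apply_symm_apply, act_one] at h
    let g : dual K D ⟶ corestrictObj f (dual K C) := dualHom _ ((dualEquiv (K := K) (C := C)).symm 1)
    obtain ⟨k, hk⟩ := η_lift g
    have hku : k.toLin u = dualEquiv.symm 1 := by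
      rw [hk, dualHom_apply, LinearEquiv.apply_symm_apply, act_one]
    have h := congrArg dualEquiv (k.act b u)
    rw [hu, map_zero, hku, dualEquiv_act] at h
    simpa using h.symm
  obtain ⟨δ, hδ⟩ := ε_section (dual K C)
  let X : RightComod.{u, v, v} K D := corestrictObj f (dual K C)
  let T : DualAlg K C × DualAlg K C → (F.obj X).carrier :=
    fun p => (F.obj X).act p.1 ((η X).toLin ((dualEquiv (K := K) (C := C)).symm p.2))
  -- The elements `b η(b')` span a subcomodule containing the image of the unit, hence span `F X`.
  have hT : δ.toLin (dualEquiv.symm 1) ∈ Submodule.span K (Set.range T) := by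
    refine mem_of_unit_mem adj₁ X _ (fun b => ?_) (fun n => ?_) _
    · suffices Submodule.span K (Set.range T) ≤
          (Submodule.span K (Set.range T)).comap ((F.obj X).act b) from this
      rw [Submodule.span_le]
      rintro _ ⟨p, rfl⟩
      refine Submodule.subset_span ⟨(b * p.1, p.2), ?_⟩
      exact act_mul _ _ _ _
    · refine Submodule.subset_span ⟨(1, dualEquiv (K := K) (C := C) n), ?_⟩
      rw [← hη]
      exact (act_one _ _).trans (congrArg _ (dualEquiv.symm_apply_apply _))
  obtain ⟨n, k, p, hp⟩ := Submodule.mem_span_set'.1 hT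
  choose q hq using fun i => (p i).2
  have sum_left (z : DualAlg K C) :
      ∑ i, dualAlgMap f (E (z * (k i • (q i).1))) * (q i).2 = z := by
    -- Apply `ε` to `z δ(1)`: the section property gives `z`, while the expansion of `δ(1)` gives
    -- the sum through `ε_act_η`.
    have h1 := hδ ((dual K C).act z (dualEquiv.symm 1))
    rw [δ.act, ← hp, map_sum, map_sum] at h1
    have h2 := congrArg (dualEquiv (K := K) (C := C)) h1
    rw [dualEquiv_act, LinearEquiv.apply_symm_apply, mul_one, map_sum] at h2
    refine Eq.trans (Finset.sum_congr rfl fun i _ => ?_) h2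
    rw [← hq i, map_smul, ← act_mul, map_smul, ε_act_η, corestrictObj_act, map_smul, dualEquiv_act,
      LinearEquiv.apply_symm_apply, mul_smul_comm, map_smul, dualAlgMap_smul, smul_mul_assoc]
  exact ⟨FrobeniusSystem.ofNondegenerate E.toAddMonoidHom E_left E_right
    (fun i => k i • (q i).1) (fun i => (q i).2) sum_left nondeg⟩

lemma IsFrobeniusCoalgExt.isFrobeniusRingExt (h : IsFrobeniusCoalgExt f) :
    IsFrobeniusRingExt (dualAlgMap f) := by
  obtain ⟨L, R, ⟨adj₁⟩, ⟨adj₂⟩, ⟨i⟩⟩ := h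
  obtain ⟨s⟩ := nonempty_frobeniusSystem_of_adjunctions (adj₁.ofNatIsoLeft i) adj₂
  exact s.isFrobeniusRingExt

end System

/-! ### Linearity of the Frobenius homomorphism over the field -/

section LinearFrobenius

variable {K : Type u} [Field K] {C D : Type v} [AddCommGroup C] [Module K C] [Coalgebra K C]
  [AddCommGroup D] [Module K D] [Coalgebra K D] {f : C →ₗc[K] D}
  (s : FrobeniusSystem (dualAlgMap f))

/-- `E` is only assumed additive, but scalars act through `φ(k • 1)`, so left linearity over `D*`
suffices. -/
lemma FrobeniusSystem.E_smul (k : K) (z : DualAlg K C) : s.E (k • z) = k • s.E z := by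
  have h : k • z = dualAlgMap f (k • 1) * z := by
    rw [dualAlgMap_smul, map_one, smul_one_mul]
  rw [h, s.map_left, smul_one_mul]

/-- The Frobenius homomorphism of a Frobenius system as a linear map. -/
def FrobeniusSystem.linearE : DualAlg K C →ₗ[K] DualAlg K D where
  toFun := s.E
  map_add' := s.E.map_add
  map_smul' := s.E_smul

lemma FrobeniusSystem.linearE_apply (z : DualAlg K C) : s.linearE z = s.E z := rfl

end LinearFrobenius

/-! ### The coinduction functor -/

namespace RightComod

variable {K : Type u} [Field K] {C D : Type v} [AddCommGroup C] [Module K C] [Coalgebra K C]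
  [AddCommGroup D] [Module K D] [Coalgebra K D] {f : C →ₗc[K] D}

variable (f) in
/-- A bilinear map `V × C* → N` is `D*`-linear in the second variable. -/
def IsDualLinear (N : RightComod.{u, v, v} K D) {V : Type*} [AddCommGroup V] [Module K V]
    (T : V →ₗ[K] DualAlg K C →ₗ[K] N.carrier) : Prop :=
  ∀ v a b, T v (dualAlgMap f a * b) = N.act a (T v b)

/-- Makes `m ↦ (b ↦ g(b • m))`, the transpose of `g`, take values in the coinduced comodule. -/
lemma isDualLinear_comp_act {M : RightComod.{u, v, v} K C} {N : RightComod.{u, v, v} K D}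
    (g : corestrictObj f M ⟶ N) :
    IsDualLinear f N (LinearMap.compRight K g.toLin ∘ₗ M.act.flip) := by
  intro m a b
  simp [act_mul, g.act_corestrict]

lemma isDualLinear_linearE (s : FrobeniusSystem (dualAlgMap f))
    (N : RightComod.{u, v, v} K D) :
    IsDualLinear f N (LinearMap.lcomp K N.carrier s.linearE ∘ₗ N.act.flip) := by
  intro n a b
  simp [s.linearE_apply, s.map_left, act_mul]

variable [FiniteDimensional K C]

section

variable (C) {V : Type v} [AddCommGroup V] [Module K V]

/-- The action of the dual algebra on `V ⊗ C = Hom(C*, V)` by right translations. -/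
def cofreeAct : DualAlg K C →ₗ[K] V ⊗[K] C →ₗ[K] V ⊗[K] C :=
  LinearMap.mk₂ K (fun b t => (sliceEquiv C V).symm (sliceEquiv C V t ∘ₗ LinearMap.mulRight K b))
    (fun b b' t => (sliceEquiv C V).injective (LinearMap.ext fun z => by simp [mul_add]))
    (fun k b t => (sliceEquiv C V).injective (LinearMap.ext fun z => by simp [mul_smul_comm]))
    (fun b t t' => (sliceEquiv C V).injective (LinearMap.ext fun z => by simp))
    (fun k b t => (sliceEquiv C V).injective (LinearMap.ext fun z => by simp))

lemma rightSlice_cofreeAct (b z : DualAlg K C) (t : V ⊗[K] C) :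
    rightSlice C V z (cofreeAct C b t) = rightSlice C V (z * b) t := by
  simp [cofreeAct]

end

variable (f)

/-- The cotensor product `N □_D C`: the tensors in `N ⊗ C` which correspond to `D*`-linear maps
`C* → N`. -/
def cotensor (N : RightComod.{u, v, v} K D) : Submodule K (N.carrier ⊗[K] C) where
  carrier := {t | ∀ (a : DualAlg K D) (b : DualAlg K C),
    rightSlice C N.carrier (dualAlgMap f a * b) t = N.act a (rightSlice C N.carrier b t)}
  add_mem' {t t'} ht ht' a b := by
    rw [map_add, map_add, map_add, ht a b, ht' a b]
  zero_mem' a b := by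
    rw [map_zero, map_zero, map_zero]
  smul_mem' k t ht a b := by
    rw [map_smul, map_smul, map_smul, ht a b]

lemma cofreeAct_mem {N : RightComod.{u, v, v} K D} (b : DualAlg K C) {t : N.carrier ⊗[K] C}
    (ht : t ∈ cotensor f N) : cofreeAct C b t ∈ cotensor f N := fun a z => by
  rw [rightSlice_cofreeAct, rightSlice_cofreeAct, mul_assoc]
  exact ht a (z * b)

/-- The action of the dual algebra on the cotensor product. -/
def cotensorAct (N : RightComod.{u, v, v} K D) :
    DualAlg K C →ₗ[K] cotensor f N →ₗ[K] cotensor f N :=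
  LinearMap.mk₂ K (fun b t => ⟨cofreeAct C b t, cofreeAct_mem f b t.2⟩)
    (fun b b' t => Subtype.ext (by simp)) (fun k b t => Subtype.ext (by simp))
    (fun b t t' => Subtype.ext (by simp)) (fun k b t => Subtype.ext (by simp))

lemma coe_cotensorAct (N : RightComod.{u, v, v} K D) (b : DualAlg K C) (t : cotensor f N) :
    (cotensorAct f N b t : N.carrier ⊗[K] C) = cofreeAct C b t := rfl

lemma rightSlice_cotensorAct (N : RightComod.{u, v, v} K D) (b z : DualAlg K C)
    (t : cotensor f N) :
    rightSlice C N.carrier z (cotensorAct f N b t) = rightSlice C N.carrier (z * b) t := by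
  rw [coe_cotensorAct, rightSlice_cofreeAct]

/-- Coinduction of a right comodule along a coalgebra map: the cotensor product `N □_D C`. -/
def coindObj (N : RightComod.{u, v, v} K D) : RightComod.{u, v, v} K C :=
  ofAct (cotensorAct f N)
    (fun t => Subtype.ext (rightSlice_ext fun b => by rw [rightSlice_cotensorAct, mul_one]))
    fun g h t => Subtype.ext (rightSlice_ext fun b => by
      rw [rightSlice_cotensorAct, rightSlice_cotensorAct, rightSlice_cotensorAct, mul_assoc])

variable {f}

/-- The value at `b` of an element of the coinduced comodule, seen as a map `C* → N`. -/
def coindEval {N : RightComod.{u, v, v} K D} :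
    DualAlg K C →ₗ[K] (coindObj f N).carrier →ₗ[K] N.carrier :=
  LinearMap.lcomp K N.carrier (cotensor f N).subtype ∘ₗ rightSlice C N.carrier

lemma coind_ext {N : RightComod.{u, v, v} K D} {t t' : (coindObj f N).carrier}
    (h : ∀ b, coindEval b t = coindEval b t') : t = t' :=
  Subtype.ext (rightSlice_ext h)

lemma coindEval_mul {N : RightComod.{u, v, v} K D} (a : DualAlg K D) (b : DualAlg K C)
    (t : (coindObj f N).carrier) :
    coindEval (dualAlgMap f a * b) t = N.act a (coindEval b t) :=
  t.2 a b

lemma coindEval_act {N : RightComod.{u, v, v} K D} (b z : DualAlg K C)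
    (t : (coindObj f N).carrier) :
    coindEval z ((coindObj f N).act b t) = coindEval (z * b) t :=
  (congrArg (coindEval z) (ofAct_act (cotensorAct f N) _ _ b t)).trans
    (rightSlice_cotensorAct f N b z t)

/-- The element of the coinduced comodule given by a `D*`-linear map `C* → N`. -/
def coindMk {N : RightComod.{u, v, v} K D} (T : DualAlg K C →ₗ[K] N.carrier)
    (hT : ∀ a b, T (dualAlgMap f a * b) = N.act a (T b)) : (coindObj f N).carrier :=
  show cotensor f N from ⟨(sliceEquiv C N.carrier).symm T, fun a b => by
    rw [rightSlice_sliceEquiv_symm, rightSlice_sliceEquiv_symm, hT]⟩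

@[simp]
lemma coindEval_mk {N : RightComod.{u, v, v} K D} (T : DualAlg K C →ₗ[K] N.carrier) (hT)
    (b : DualAlg K C) : coindEval b (coindMk (f := f) T hT) = T b :=
  rightSlice_sliceEquiv_symm T b

/-- The map to a coinduced comodule given by a bilinear map. -/
def coindLift {N : RightComod.{u, v, v} K D} {V : Type*} [AddCommGroup V] [Module K V]
    (T : V →ₗ[K] DualAlg K C →ₗ[K] N.carrier)
    (hT : IsDualLinear f N T) :
    V →ₗ[K] (coindObj f N).carrier where
  toFun v := coindMk (T v) (hT v)
  map_add' v w := coind_ext fun b => by simp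
  map_smul' k v := coind_ext fun b => by simp

@[simp]
lemma coindEval_coindLift {N : RightComod.{u, v, v} K D} {V : Type*} [AddCommGroup V]
    [Module K V] (T : V →ₗ[K] DualAlg K C →ₗ[K] N.carrier)
    (hT : IsDualLinear f N T) (v : V) (b : DualAlg K C) :
    coindEval b (coindLift T hT v) = T v b :=
  coindEval_mk (T v) (hT v) b

lemma isDualLinear_comp_coindEval {N N' : RightComod.{u, v, v} K D} (g : N ⟶ N') :
    IsDualLinear f N' (LinearMap.compRight K g.toLin ∘ₗ (coindEval (f := f) (N := N)).flip) := by
  intro t a b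
  simp [coindEval_mul, g.act]

/-- The morphism of coinduced comodules given by composition with a morphism. -/
def coindMap {N N' : RightComod.{u, v, v} K D} (g : N ⟶ N') : coindObj f N ⟶ coindObj f N' :=
  homOfAct (coindLift _ (isDualLinear_comp_coindEval g))
    fun b t => coind_ext fun z => by simp [coindEval_act]

@[simp]
lemma coindEval_coindMap {N N' : RightComod.{u, v, v} K D} (g : N ⟶ N') (b : DualAlg K C)
    (t : (coindObj f N).carrier) :
    coindEval b ((coindMap g).toLin t) = g.toLin (coindEval b t) := by
  simp [coindMap]

variable (f) in
/-- The coinduction functor. -/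
def coind : RightComod.{u, v, v} K D ⥤ RightComod.{u, v, v} K C where
  obj N := coindObj f N
  map g := coindMap g
  map_id N := hom_ext fun t => coind_ext fun b => by simp
  map_comp g h := hom_ext fun t => coind_ext fun b => by simp

/-- The bijection underlying the adjunction between corestriction and coinduction. -/
def corestrictCoindEquiv (M : RightComod.{u, v, v} K C) (N : RightComod.{u, v, v} K D) :
    (corestrictObj f M ⟶ N) ≃ (M ⟶ coindObj f N) where
  toFun g := homOfAct (coindLift _ (isDualLinear_comp_act g))
    fun b m => coind_ext fun z => by simp [coindEval_act, act_mul]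
  invFun h := homOfAct (M := corestrictObj f M) (coindEval 1 ∘ₗ h.toLin) fun a m => by
    simp only [LinearMap.comp_apply]
    rw [corestrictObj_act, h.act, coindEval_act, one_mul, ← coindEval_mul, mul_one]
  left_inv g := hom_ext fun m => by
    simp [act_one]
  right_inv h := hom_ext fun m => coind_ext fun b => by
    simp [h.act, coindEval_act]

lemma coindEval_corestrictCoindEquiv {M : RightComod.{u, v, v} K C}
    {N : RightComod.{u, v, v} K D} (g : corestrictObj f M ⟶ N) (m : M.carrier)
    (b : DualAlg K C) :
    coindEval b ((corestrictCoindEquiv M N g).toLin m) = g.toLin (M.act b m) :=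
  coindEval_coindLift _ (isDualLinear_comp_act g) m b

variable (f) in
/-- Coinduction is right adjoint to corestriction. -/
def corestrictCoindAdjunction : corestrict.{u, v, v} f ⊣ coind f :=
  Adjunction.mkOfHomEquiv
    { homEquiv := corestrictCoindEquiv
      homEquiv_naturality_left_symm := fun _ _ => rfl
      homEquiv_naturality_right := fun {M N N'} g h => hom_ext fun m => coind_ext fun b => by
        refine (coindEval_corestrictCoindEquiv (g ≫ h) m b).trans ?_
        refine Eq.trans ?_ (coindEval_coindMap h b _).symm
        exact congrArg h.toLin (coindEval_corestrictCoindEquiv g m b).symm }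

variable (s : FrobeniusSystem (dualAlgMap f))

/-- The unit `n ↦ (z ↦ E(z) n)` of the Frobenius adjunction. -/
def frobeniusUnit (N : RightComod.{u, v, v} K D) : N.carrier →ₗ[K] (coindObj f N).carrier :=
  coindLift _ (isDualLinear_linearE s N)

@[simp]
lemma coindEval_frobeniusUnit (N : RightComod.{u, v, v} K D) (n : N.carrier) (b : DualAlg K C) :
    coindEval b (frobeniusUnit s N n) = N.act (s.E b) n := by
  simp [frobeniusUnit, s.linearE_apply]

/-- Right linearity of `E` enters here; left linearity was what put `z ↦ E(z) n` in the coinduced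
comodule. -/
lemma frobeniusUnit_act (N : RightComod.{u, v, v} K D) (n : N.carrier) (a : DualAlg K D) :
    frobeniusUnit s N (N.act a n) = (coindObj f N).act (dualAlgMap f a) (frobeniusUnit s N n) :=
  coind_ext fun b => by simp [coindEval_act, s.map_right, act_mul]

/-- Evaluate at `b`, expand `b` with `sum_left` and use `D*`-linearity of `t`. A morphism out of the
coinduced comodule is thus determined on the image of the unit. -/
lemma coind_eq_sum (N : RightComod.{u, v, v} K D) (t : (coindObj f N).carrier) :
    ∑ i, (coindObj f N).act (s.x i) (frobeniusUnit s N (coindEval (s.y i) t)) = t :=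
  coind_ext fun b => by
    conv_rhs => rw [← s.sum_left b, map_sum, LinearMap.sum_apply]
    rw [map_sum]
    refine Finset.sum_congr rfl fun i _ => ?_
    rw [coindEval_act, coindEval_frobeniusUnit, coindEval_mul]

/-- The bijection underlying the adjunction between coinduction and corestriction along a Frobenius
extension. -/
def coindCorestrictEquiv (N : RightComod.{u, v, v} K D) (M : RightComod.{u, v, v} K C) :
    (coindObj f N ⟶ M) ≃ (N ⟶ corestrictObj f M) where
  toFun h := homOfAct (N := corestrictObj f M) (h.toLin ∘ₗ frobeniusUnit s N) fun a n => by
    simp only [LinearMap.comp_apply]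
    rw [frobeniusUnit_act, h.act, corestrictObj_act]
  -- The formula is forced by `coind_eq_sum`. For linearity, expand `yᵢ b` in the `yⱼ`, move the
  -- coefficients past `k`, and recombine with `∑ xᵢ φ(E(yᵢ b xⱼ)) = b xⱼ`.
  invFun k := homOfAct (∑ i, M.act (s.x i) ∘ₗ k.toLin ∘ₗ coindEval (s.y i)) fun b t => by
    simp only [LinearMap.sum_apply, LinearMap.comp_apply, coindEval_act, map_sum]
    have hy (i) : M.act (s.x i) (k.toLin (coindEval (s.y i * b) t)) =
        ∑ j, M.act (s.x i * dualAlgMap f (s.E (s.y i * (b * s.x j))))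
          (k.toLin (coindEval (s.y j) t)) := by
      conv_lhs => rw [← s.sum_left (s.y i * b)]
      rw [map_sum, LinearMap.sum_apply, map_sum, map_sum]
      refine Finset.sum_congr rfl fun j _ => ?_
      rw [coindEval_mul, k.act_to_corestrict, act_mul, mul_assoc]
    simp_rw [hy]
    rw [Finset.sum_comm]
    refine Finset.sum_congr rfl fun j _ => ?_
    rw [← LinearMap.sum_apply, ← map_sum, s.sum_right, act_mul]
  left_inv h := hom_ext fun t => by
    conv_rhs => rw [← coind_eq_sum s N t, map_sum]
    simp [h.act]
  right_inv k := hom_ext fun n => by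
    have h (i) : M.act (s.x i) (k.toLin (N.act (s.E (s.y i)) n)) =
        M.act (s.x i * dualAlgMap f (s.E (s.y i * 1))) (k.toLin n) := by
      rw [k.act_to_corestrict, act_mul, mul_one]
    simp only [homOfAct_toLin, LinearMap.comp_apply, LinearMap.sum_apply, coindEval_frobeniusUnit]
    simp_rw [h]
    rw [← LinearMap.sum_apply, ← map_sum, s.sum_right, act_one]

lemma coindCorestrictEquiv_symm_apply {N : RightComod.{u, v, v} K D}
    {M : RightComod.{u, v, v} K C} (k : N ⟶ corestrictObj f M) (t : (coindObj f N).carrier) :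
    ((coindCorestrictEquiv s N M).symm k).toLin t =
      ∑ i, M.act (s.x i) (k.toLin (coindEval (s.y i) t)) :=
  LinearMap.sum_apply _ _ t

/-- Coinduction along a Frobenius extension is left adjoint to corestriction. -/
def coindCorestrictAdjunction : coind f ⊣ corestrict.{u, v, v} f :=
  Adjunction.mkOfHomEquiv
    { homEquiv := coindCorestrictEquiv s
      homEquiv_naturality_left_symm := fun {N' N M} g k => hom_ext fun t => by
        refine (coindCorestrictEquiv_symm_apply s (g ≫ k) t).trans ?_
        refine Eq.trans ?_ (coindCorestrictEquiv_symm_apply s k ((coindMap g).toLin t)).symm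
        exact Finset.sum_congr rfl fun i _ =>
          congrArg (M.act (s.x i)) (congrArg k.toLin (coindEval_coindMap g (s.y i) t).symm)
      homEquiv_naturality_right := fun _ _ => rfl }

end RightComod

lemma FrobeniusSystem.isFrobeniusCoalgExt {K : Type u} [Field K] {C D : Type v}
    [AddCommGroup C] [Module K C] [Coalgebra K C] [AddCommGroup D] [Module K D] [Coalgebra K D]
    [FiniteDimensional K C] {f : C →ₗc[K] D} (s : FrobeniusSystem (dualAlgMap f)) :
    IsFrobeniusCoalgExt f :=
  ⟨RightComod.coind f, RightComod.coind f, ⟨RightComod.coindCorestrictAdjunction s⟩,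
    ⟨RightComod.corestrictCoindAdjunction f⟩, ⟨Iso.refl _⟩⟩

/-! ### The action of the dual algebra on a left comodule -/

namespace LeftComod

variable {K : Type u} [Field K] {C : Type v} [AddCommGroup C] [Module K C] [Coalgebra K C]

/-- The right action `m • b = b(m₋₁) m₀` of the dual algebra on a left comodule. -/
def act (M : LeftComod.{u, v, w} K C) (b : DualAlg K C) : M.carrier →ₗ[K] M.carrier :=
  leftSlice C M.carrier b ∘ₗ M.coact

lemma act_apply (M : LeftComod.{u, v, w} K C) (b : DualAlg K C) (m : M.carrier) :
    M.act b m = leftSlice C M.carrier b (M.coact m) := rfl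

lemma act_add (M : LeftComod.{u, v, w} K C) (b b' : DualAlg K C) (m : M.carrier) :
    M.act (b + b') m = M.act b m + M.act b' m := by
  simp [act, leftSlice]

lemma act_smul (M : LeftComod.{u, v, w} K C) (k : K) (b : DualAlg K C) (m : M.carrier) :
    M.act (k • b) m = k • M.act b m := by
  simp [act, leftSlice]

lemma act_one (M : LeftComod.{u, v, w} K C) (m : M.carrier) : M.act 1 m = m := by
  rw [act_apply, leftSlice_one]
  exact LinearMap.congr_fun M.coact_counit m

lemma act_mul (M : LeftComod.{u, v, w} K C) (g h : DualAlg K C) (m : M.carrier) :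
    M.act (g * h) m = M.act h (M.act g m) := by
  have hc := LinearMap.congr_fun M.coact_coassoc m
  simp only [LinearMap.comp_apply, LinearEquiv.coe_coe] at hc
  rw [act_apply, leftSlice_mul, hc, leftSlice_lTensor]
  rfl

lemma Hom.act {M N : LeftComod.{u, v, w} K C} (g : M ⟶ N) (b : DualAlg K C) (m : M.carrier) :
    g.toLin (M.act b m) = N.act b (g.toLin m) := by
  have hc := LinearMap.congr_fun g.comm m
  simp only [LinearMap.comp_apply] at hc
  rw [act_apply, act_apply, ← hc, leftSlice_lTensor]

lemma hom_ext {M N : LeftComod.{u, v, w} K C} {g h : M ⟶ N}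
    (H : ∀ m, g.toLin m = h.toLin m) : g = h :=
  Hom.ext (LinearMap.ext H)

/-- A linear map commuting with the actions of the dual algebra is a morphism of comodules. -/
def homOfAct {M N : LeftComod.{u, v, w} K C} (g : M.carrier →ₗ[K] N.carrier)
    (h : ∀ b m, g (M.act b m) = N.act b (g m)) : M ⟶ N where
  toLin := g
  comm := LinearMap.ext fun m => leftSlice_ext fun b => by
    simp only [LinearMap.comp_apply]
    rw [leftSlice_lTensor, ← act_apply, h, act_apply]

/-- A coaction is determined by, and may be checked on, its slices. -/
abbrev ofSlice {V : Type w} [AddCommGroup V] [Module K V] (ρ : V →ₗ[K] C ⊗[K] V)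
    (h_one : ∀ v, leftSlice C V 1 (ρ v) = v)
    (h_mul : ∀ g h v, leftSlice C V (g * h) (ρ v) =
      leftSlice C V h (ρ (leftSlice C V g (ρ v)))) : LeftComod.{u, v, w} K C where
  carrier := V
  coact := ρ
  coact_coassoc := LinearMap.ext fun v => by
    simp only [LinearMap.comp_apply, LinearEquiv.coe_coe]
    refine leftSlice_ext fun g => leftSlice_ext fun h => ?_
    rw [← leftSlice_mul, leftSlice_lTensor, h_mul]
  coact_counit := LinearMap.ext fun v => by
    simp only [LinearMap.comp_apply, LinearEquiv.coe_coe, LinearMap.id_apply]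
    rw [← leftSlice_one, h_one]

/-- The restriction of the coaction to a subspace stable under the action of the dual algebra. -/
def subCoact (M : LeftComod.{u, v, w} K C) (W : Submodule K M.carrier)
    (hW : ∀ b, ∀ m ∈ W, M.act b m ∈ W) : W →ₗ[K] C ⊗[K] W :=
  (LinearEquiv.ofInjective (W.subtype.lTensor C)
    (Module.Flat.lTensor_preserves_injective_linearMap _ W.injective_subtype)).symm.toLinearMap ∘ₗ
    LinearMap.codRestrict _ (M.coact ∘ₗ W.subtype)
      fun m => mem_range_lTensor_of_leftSlice_mem W fun b => hW b m m.2

lemma leftSlice_subCoact (M : LeftComod.{u, v, w} K C) (W : Submodule K M.carrier) (hW)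
    (b : DualAlg K C) (m : W) :
    (leftSlice C W b (M.subCoact W hW m) : M.carrier) = M.act b m := by
  have h1 : W.subtype.lTensor C (M.subCoact W hW m) = M.coact m :=
    congrArg Subtype.val (LinearEquiv.apply_symm_apply (LinearEquiv.ofInjective (W.subtype.lTensor C)
      (Module.Flat.lTensor_preserves_injective_linearMap _ W.injective_subtype)) _)
  rw [act_apply, ← h1, leftSlice_lTensor]
  rfl

/-- The subcomodule carried by a subspace stable under the action of the dual algebra. -/
abbrev sub (M : LeftComod.{u, v, w} K C) (W : Submodule K M.carrier)
    (hW : ∀ b, ∀ m ∈ W, M.act b m ∈ W) : LeftComod.{u, v, w} K C :=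
  ofSlice (M.subCoact W hW) (fun v => Subtype.ext (by rw [leftSlice_subCoact, act_one]))
    fun g h v => Subtype.ext (by
      rw [leftSlice_subCoact, act_mul, leftSlice_subCoact, leftSlice_subCoact])

/-- The inclusion of a subcomodule. -/
def subIncl (M : LeftComod.{u, v, w} K C) (W : Submodule K M.carrier) (hW) : M.sub W hW ⟶ M :=
  homOfAct (M := M.sub W hW) W.subtype fun b m => M.leftSlice_subCoact W hW b m

lemma injective_of_mono {M N : LeftComod.{u, v, w} K C} (g : M ⟶ N) [Mono g] :
    Function.Injective g.toLin := by
  rw [← LinearMap.ker_eq_bot]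
  have hW (b : DualAlg K C) : ∀ m ∈ LinearMap.ker g.toLin, M.act b m ∈ LinearMap.ker g.toLin := by
    intro m hm
    rw [LinearMap.mem_ker] at hm ⊢
    rw [g.act, hm, map_zero]
  have h : M.subIncl _ hW = homOfAct 0 (by simp) := by
    rw [← cancel_mono g]
    refine hom_ext fun m => ?_
    have hm : g.toLin (Submodule.subtype _ m) = 0 := m.2
    exact hm.trans (map_zero g.toLin).symm
  rw [eq_bot_iff]
  intro m hm
  exact LinearMap.congr_fun (congrArg Hom.toLin h) (⟨m, hm⟩ : LinearMap.ker g.toLin)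

/-- On this side the action is the transpose of left multiplication. -/
lemma apply_act_regular (b b' : DualAlg K C) (c : C) : b' ((regular K C).act b c) = (b * b') c := by
  rw [act_apply, LinearMap.convMul_apply]
  change b' (leftSlice C C b (Coalgebra.comul c)) = _
  induction (Coalgebra.comul (R := K) c) with
  | zero => simp
  | tmul x y => simp
  | add s t hs ht => simp only [map_add, hs, ht]

lemma power_act (n : ℕ) (b : DualAlg K C) (v : Fin n → C) (i : Fin n) :
    (power K C n).act b v i = (regular K C).act b (v i) := by
  rw [act_apply]
  change leftSlice C (Fin n → C) b (LinearMap.lsum K (fun _ : Fin n => C) K (fun i =>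
    (LinearMap.single K (fun _ : Fin n => C) i).lTensor C ∘ₗ Coalgebra.comul) v) i = _
  simp only [LinearMap.lsum_apply, LinearMap.sum_apply, LinearMap.comp_apply, LinearMap.proj_apply,
    map_sum, leftSlice_lTensor, Finset.sum_apply, LinearMap.single_apply]
  rw [Finset.sum_eq_single i (fun j _ hj => Pi.single_eq_of_ne hj.symm _) (by simp),
    Pi.single_eq_same]
  rfl

end LeftComod

namespace RightComod

variable {K : Type u} [Field K] {C : Type v} [AddCommGroup C] [Module K C] [Coalgebra K C]

lemma power_act (n : ℕ) (b : DualAlg K C) (v : Fin n → C) (i : Fin n) :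
    (power K C n).act b v i = (regular K C).act b (v i) := by
  rw [act_apply]
  change rightSlice C (Fin n → C) b (LinearMap.lsum K (fun _ : Fin n => C) K (fun i =>
    (LinearMap.single K (fun _ : Fin n => C) i).rTensor C ∘ₗ Coalgebra.comul) v) i = _
  simp only [LinearMap.lsum_apply, LinearMap.sum_apply, LinearMap.comp_apply, LinearMap.proj_apply,
    map_sum, rightSlice_rTensor, Finset.sum_apply, LinearMap.single_apply]
  rw [Finset.sum_eq_single i (fun j _ hj => Pi.single_eq_of_ne hj.symm _) (by simp),
    Pi.single_eq_same]
  rfl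

end RightComod

/-! ### Finite cogeneration and injectivity -/

section

variable {K : Type u} [Field K] {C : Type v} [AddCommGroup C] [Module K C]

variable (K C) in
lemma finite_dualAlg [FiniteDimensional K C] : Module.Finite K (DualAlg K C) :=
  Module.Finite.equiv (WithConv.linearEquiv K (C →ₗ[K] K)).symm

/-- A map to a finite-dimensional space is given by its composites with all functionals. -/
lemma exists_linearMap_forall_dualAlg_apply [FiniteDimensional K C] {V : Type*} [AddCommGroup V]
    [Module K V] (T : DualAlg K C → V → K)
    (add_left : ∀ z z' v, T (z + z') v = T z v + T z' v)
    (smul_left : ∀ (k : K) z v, T (k • z) v = k • T z v)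
    (add_right : ∀ z v v', T z (v + v') = T z v + T z v')
    (smul_right : ∀ (k : K) z v, T z (k • v) = k • T z v) :
    ∃ G : V →ₗ[K] C, ∀ (z : DualAlg K C) v, z (G v) = T z v := by
  let T' : DualAlg K C →ₗ[K] V →ₗ[K] K :=
    LinearMap.mk₂ K T add_left smul_left add_right fun k z v => smul_right k z v
  refine ⟨(Module.evalEquiv K C).symm.toLinearMap ∘ₗ
    (T' ∘ₗ (WithConv.linearEquiv K (C →ₗ[K] K)).symm.toLinearMap).flip, fun z v => ?_⟩
  simp [T', Module.apply_evalEquiv_symm_apply]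

/-- Each coordinate `eᵢ` on `M` yields a colinear map to `C`, sending `m` to the element
representing `z ↦ eᵢ(z • m)` in `C** = C`. Taking `z = 1` recovers all coordinates of `m`, so
jointly these maps are injective. -/
lemma RightComod.finitelyCogenerated [Coalgebra K C] [FiniteDimensional K C]
    (M : RightComod.{u, v, v} K C) [FiniteDimensional K M.carrier] : M.FinitelyCogenerated := by
  let e := Module.finBasis K M.carrier
  choose G hG using fun i => exists_linearMap_forall_dualAlg_apply (C := C)
    (fun (z : DualAlg K C) m => e.coord i (M.act z m)) (by simp) (by simp) (by simp) (by simp)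
  refine ⟨_, homOfAct (N := power K C _) (LinearMap.pi G) fun b m => funext fun i =>
    eq_of_forall_dualAlg_apply (K := K) fun z => ?_, (injective_iff_map_eq_zero _).2 fun m hm => ?_⟩
  · rw [power_act, apply_act_regular, LinearMap.pi_apply, LinearMap.pi_apply, hG, hG, act_mul]
  · refine e.ext_elem fun i => ?_
    have h := hG i 1 m
    rw [act_one, show G i m = 0 from congrFun hm i, map_zero] at h
    rw [map_zero]
    exact h.symm

lemma LeftComod.finitelyCogenerated [Coalgebra K C] [FiniteDimensional K C]
    (M : LeftComod.{u, v, v} K C) [FiniteDimensional K M.carrier] : M.FinitelyCogenerated := by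
  let e := Module.finBasis K M.carrier
  choose G hG using fun i => exists_linearMap_forall_dualAlg_apply (C := C)
    (fun (z : DualAlg K C) m => e.coord i (M.act z m)) (by simp [act_add]) (by simp [act_smul])
    (by simp) (by simp)
  refine ⟨_, homOfAct (N := power K C _) (LinearMap.pi G) fun b m => funext fun i =>
    eq_of_forall_dualAlg_apply (K := K) fun z => ?_, (injective_iff_map_eq_zero _).2 fun m hm => ?_⟩
  · rw [power_act, apply_act_regular, LinearMap.pi_apply, LinearMap.pi_apply, hG, hG, act_mul]
  · refine e.ext_elem fun i => ?_
    have h := hG i 1 m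
    rw [act_one, show G i m = 0 from congrFun hm i, map_zero] at h
    rw [map_zero]
    exact h.symm

end

/-! ### Injectivity over `D` and finiteness over `D*` -/

section

variable {K : Type u} [Field K] {C D : Type v} [AddCommGroup C] [Module K C] [Coalgebra K C]
  [AddCommGroup D] [Module K D] [Coalgebra K D] {f : C →ₗc[K] D}

lemma LeftComod.corestrictObj_act (M : LeftComod.{u, v, w} K C) (a : DualAlg K D)
    (m : M.carrier) : (corestrictObj f M).act a m = M.act (dualAlgMap f a) m :=
  leftSlice_rTensor f a (M.coact m)

namespace FrobeniusSystem

variable [FiniteDimensional K C]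

/-- A linear retraction `r` of `i` is averaged: the extension `G` satisfies `z(G y) = ∑ xⱼ(g(r(E(yⱼ
z) • y)))`. Right linearity of `E` makes `G` colinear, and `sum_right` makes it extend `g`. -/
lemma injective_right (s : FrobeniusSystem (dualAlgMap f)) :
    Injective (RightComod.corestrictObj f (RightComod.regular K C)) where
  factors {X Y} g i _ := by
    obtain ⟨r, hr⟩ := i.toLin.exists_leftInverse_of_injective
      (LinearMap.ker_eq_bot.2 (RightComod.injective_of_mono i))
    obtain ⟨G, hG⟩ := exists_linearMap_forall_dualAlg_apply (C := C)
      (fun z y => ∑ j, s.x j (g.toLin (r (Y.act (s.E (s.y j * z)) y))))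
      (by simp [mul_add, Finset.sum_add_distrib]) (by simp [s.E_smul, Finset.mul_sum, mul_smul_comm])
      (by simp [Finset.sum_add_distrib]) (by simp [Finset.mul_sum])
    refine ⟨RightComod.homOfAct (N := RightComod.corestrictObj f (RightComod.regular K C)) G
      fun a y => eq_of_forall_dualAlg_apply (K := K) fun z => ?_,
      RightComod.hom_ext fun x => eq_of_forall_dualAlg_apply (K := K) fun z => ?_⟩
    · rw [RightComod.corestrictObj_act, RightComod.apply_act_regular, hG, hG]
      refine Finset.sum_congr rfl fun j _ => ?_
      rw [← mul_assoc, s.map_right, RightComod.act_mul]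
    · refine (hG z (i.toLin x)).trans ?_
      conv_rhs => rw [← s.sum_right z]
      rw [WithConv.ofConv_sum, LinearMap.sum_apply]
      refine Finset.sum_congr rfl fun j _ => ?_
      rw [← i.act, ← LinearMap.comp_apply r, hr, LinearMap.id_apply, g.act,
        RightComod.corestrictObj_act, RightComod.apply_act_regular]

/-- The mirror image: the dual bases exchange roles, and left linearity of `E` and `sum_left` are
used. -/
lemma injective_left (s : FrobeniusSystem (dualAlgMap f)) :
    Injective (LeftComod.corestrictObj f (LeftComod.regular K C)) where
  factors {X Y} g i _ := by
    obtain ⟨r, hr⟩ := i.toLin.exists_leftInverse_of_injective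
      (LinearMap.ker_eq_bot.2 (LeftComod.injective_of_mono i))
    obtain ⟨G, hG⟩ := exists_linearMap_forall_dualAlg_apply (C := C)
      (fun z y => ∑ j, s.y j (g.toLin (r (Y.act (s.E (z * s.x j)) y))))
      (by simp [add_mul, LeftComod.act_add, Finset.sum_add_distrib])
      (by simp [s.E_smul, LeftComod.act_smul, Finset.mul_sum, smul_mul_assoc])
      (by simp [Finset.sum_add_distrib]) (by simp [Finset.mul_sum])
    refine ⟨LeftComod.homOfAct (N := LeftComod.corestrictObj f (LeftComod.regular K C)) G
      fun a y => eq_of_forall_dualAlg_apply (K := K) fun z => ?_,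
      LeftComod.hom_ext fun x => eq_of_forall_dualAlg_apply (K := K) fun z => ?_⟩
    · rw [LeftComod.corestrictObj_act, LeftComod.apply_act_regular, hG, hG]
      refine Finset.sum_congr rfl fun j _ => ?_
      rw [mul_assoc, s.map_left, LeftComod.act_mul]
    · refine (hG z (i.toLin x)).trans ?_
      conv_rhs => rw [← s.sum_left z]
      rw [WithConv.ofConv_sum, LinearMap.sum_apply]
      refine Finset.sum_congr rfl fun j _ => ?_
      rw [← i.act, ← LinearMap.comp_apply r, hr, LinearMap.id_apply, g.act,
        LeftComod.corestrictObj_act, LeftComod.apply_act_regular]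

end FrobeniusSystem

lemma leftModuleFinite_dualAlgMap [FiniteDimensional K C] : LeftModuleFinite (dualAlgMap f) := by
  let : Module (DualAlg K D) (DualAlg K C) := Module.compHom _ (dualAlgMap f)
  have : IsScalarTower K (DualAlg K D) (DualAlg K C) :=
    ⟨fun k a b => smul_mul_assoc k (dualAlgMap f a) b⟩
  have := finite_dualAlg K C
  exact Module.Finite.of_restrictScalars_finite K _ _

lemma rightModuleFinite_dualAlgMap [FiniteDimensional K C] : RightModuleFinite (dualAlgMap f) := by
  let : Module (DualAlg K D)ᵐᵒᵖ (DualAlg K C) := Module.compHom _ (dualAlgMap f).op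
  have : IsScalarTower K (DualAlg K D)ᵐᵒᵖ (DualAlg K C) :=
    ⟨fun k a b => mul_smul_comm k b (dualAlgMap f a.unop)⟩
  have := finite_dualAlg K C
  exact Module.Finite.of_restrictScalars_finite K _ _

/-- Finiteness passes from `K` to `D*` to `C*`, and a space with finite-dimensional dual is finite
dimensional. -/
lemma finiteDimensional_of_leftModuleFinite [FiniteDimensional K D]
    (h : LeftModuleFinite (dualAlgMap f)) : FiniteDimensional K C := by
  let : Module (DualAlg K D) (DualAlg K C) := Module.compHom _ (dualAlgMap f)
  have : IsScalarTower K (DualAlg K D) (DualAlg K C) :=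
    ⟨fun k a b => smul_mul_assoc k (dualAlgMap f a) b⟩
  have := finite_dualAlg K D
  have : Module.Finite (DualAlg K D) (DualAlg K C) := h
  have : Module.Finite K (DualAlg K C) := Module.Finite.trans (DualAlg K D) _
  have : Module.Finite K (Module.Dual K C) :=
    Module.Finite.equiv (WithConv.linearEquiv K (C →ₗ[K] K))
  exact (Module.finite_dual_iff K).1 this

end

end

/-! ### The equivalence and its consequences -/

theorem proposition3p9 {K : Type u} [Field K] {C D : Type v}
    [AddCommGroup C] [Module K C] [Coalgebra K C]
    [AddCommGroup D] [Module K D] [Coalgebra K D]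
    (f : C →ₗc[K] D) [FiniteDimensional K D] :
    (IsFrobeniusCoalgExt f ↔ IsFrobeniusRingExt (dualAlgMap f)) ∧
    (IsFrobeniusCoalgExt f →
      FiniteDimensional K C ∧
      (CategoryTheory.Injective (RightComod.corestrictObj f (RightComod.regular K C)) ∧
        (RightComod.corestrictObj f (RightComod.regular K C)).FinitelyCogenerated) ∧
      (CategoryTheory.Injective (LeftComod.corestrictObj f (LeftComod.regular K C)) ∧
        (LeftComod.corestrictObj f (LeftComod.regular K C)).FinitelyCogenerated) ∧
      LeftModuleFinite (dualAlgMap f) ∧ RightModuleFinite (dualAlgMap f)) := by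
  have ring_of_coalg (h : IsFrobeniusCoalgExt f) : IsFrobeniusRingExt (dualAlgMap f) :=
    have := h.finiteDimensional
    h.isFrobeniusRingExt
  refine ⟨⟨ring_of_coalg, fun h => ?_⟩, fun h => ?_⟩
  · have := finiteDimensional_of_leftModuleFinite h.1
    obtain ⟨s⟩ := h.nonempty_frobeniusSystem
    exact s.isFrobeniusCoalgExt
  · have := h.finiteDimensional
    obtain ⟨s⟩ := (ring_of_coalg h).nonempty_frobeniusSystem
    exact ⟨this, ⟨s.injective_right, RightComod.finitelyCogenerated _⟩,
      ⟨s.injective_left, LeftComod.finitelyCogenerated _⟩,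
      leftModuleFinite_dualAlgMap, rightModuleFinite_dualAlgMap⟩
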